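/- Let $p$ be a prime, let $(A,(p))$ be a crystalline prism (a $p$-torsion free, $p$-adically complete $\delta$-ring $A$), and put $A_0=A/p$. Let $R_0$ be an $A_0$-algebra with an étale map of $A_0$-algebras $\Box\colon A_0[T_1^{\pm1},\dots,T_d^{\pm1}]\to R_0$, let $R$ be a $p$-completely smooth $A$-algebra with $R/p\cong R_0$, and let $\underline T=(T_1,\dots,T_d)$ be elements of $R$ lifting the images of the coordinates under $\Box$. Let $\delta_1,\delta_2$ be $\delta$-structures on $R$ compatible with that of $A$ and such that $\delta_1(x)\equiv\delta_2(x)\bmod p$ for all $x\in R$. Write $(R_i,(p))$ for the prism $(R,(p),\delta_i)$, with coordinates denoted $\underline T$ for $i=1$ and $\underline S$ for $i=2$. Let $(R_0/A)_{\Delta}$ be the category of $p$-torsion free, $p$-complete $\delta$-$A$-algebras $B$ equipped with a map of $A$-algebras $R_0\to B/p$; morphisms are maps of $\delta$-$A$-algebras compatible with the maps from $R_0$. Coproducts are taken in this category (in the direction of ring maps). For a ring $S$, let $S[\underline X_1,\dots,\underline X_n]^\wedge_{\mathrm{pd}}$ denote the $p$-adic completion of the free pd-algebra over $S$ on the $nd$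 variables $\underline X_j=(X_{j,1},\dots,X_{j,d})$, $1\le j\le n$. For a cosimplicial ring, $p_i$ is the face map induced by the injection $[n]\to[n+1]$ omitting $i$, and $\sigma_i$ is the degeneracy map induced by the surjection $[n+1]\to[n]$ taking the value $i$ twice. (1) For every $n\ge0$ the coproduct $R_1^n$ of $n+1$ copies of $(R_1,(p))$ exists. Let $\underline T_j$ be the coordinates of the $(j+1)$-th copy ($0\le j\le n$). There is an isomorphism of cosimplicial rings $R_1^\bullet\cong R_1[\underline X_1,\dots,\underline X_\bullet]^\wedge_{\mathrm{pd}}$ which is $R_1$-linear in each degree (via the first copy of $R_1$) and under which $\underline X_j$ corresponds to $(\underline T_0-\underline T_j)/p$. Here the structure maps of the right hand side are the unique ring homomorphisms with the following properties. For $i\ge1$ the face map $p_i$ is $R_1$-linear; the face map $p_0$ is $A$-linear, satisfies $p_0(r)\equiv r\bmod p$ for $r\in R_1$, and $p_0(\underline T)=\underline T-p\underline X_1$; and $$p_i(\underline X_j)=\begin{cases}\underline X_{j+1}-\underline X_1,& i=0,\\ \underline X_{j+1},&0<i\le j,\\ \underline X_j,& i>j.\end{cases}$$ The degeneracy maps $\sigma_i$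 are $R_1$-linear, and $$\sigma_i(\underline X_j)=\begin{cases}0,&(i,j)=(0,1),\\ \underline X_{j-1},& i<j,\ (i,j)\ne(0,1),\\ \underline X_j,& i\ge j.\end{cases}$$ The same holds for $R_2$, with $\underline S$ and $\underline Z_j=(\underline S_0-\underline S_j)/p$ in place of $\underline T$ and $\underline X_j$. (2) The coproduct $R_{12}$ of $(R_1,(p))$ and $(R_2,(p))$ exists, and so does, for every $n\ge0$, the coproduct $\widetilde R^n$ of $(R_1,(p))$ with $n+1$ copies of $(R_2,(p))$. Let $\underline T$ be the coordinates of $R_1$ and $\underline S_j$ those of the $(j+1)$-th copy of $R_2$. There is $\underline Y=(\underline T-\underline S)/p$ in $R_{12}$ (equal to $(\underline T-\underline S_0)/p$ in $\widetilde R^n$), and for every $n$ there is an $R_1$-linear isomorphism $R_1[\underline Y,\underline Z_1,\dots,\underline Z_n]^\wedge_{\mathrm{pd}}\cong R_{12}[\underline Z_1,\dots,\underline Z_n]^\wedge_{\mathrm{pd}}$ sending the variables $\underline Y$ to the elements $\underline Y$ of $R_{12}$ and $\underline Z_j$ to $\underline Z_j$. There is an isomorphism of cosimplicial rings $\widetilde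 R^\bullet\cong R_{12}[\underline Z_1,\dots,\underline Z_\bullet]^\wedge_{\mathrm{pd}}$ which is $R_{12}$-linear in each degree (via $R_1$ and the first copy of $R_2$) and under which $\underline Z_j$ corresponds to $(\underline S_0-\underline S_j)/p$. Here the structure maps of the right hand side are the unique ring homomorphisms with the following properties. The face maps $p_i$ are $R_1$-linear, with $p_0(\underline Y)=\underline Y+\underline Z_1$, $p_i(\underline Y)=\underline Y$ for $i\ge1$, and $$p_i(\underline Z_j)=\begin{cases}\underline Z_{j+1}-\underline Z_1,& i=0,\\ \underline Z_{j+1},&0<i\le j,\\ \underline Z_j,& i>j.\end{cases}$$ The degeneracy maps $\sigma_i$ are $R_{12}$-linear, and given on the $\underline Z_j$ by the formulas for $\sigma_i(\underline X_j)$ in (1). -/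

import Mathlib

open CategoryTheory CategoryTheory.Limits
open scoped TensorProduct

universe u

/-- A `δ`-structure (with respect to `p`) on a commutative ring. The natural number
`p.choose i / p` is the exact quotient of the binomial coefficient, as `0 < i < p`. -/
@[ext]
structure DeltaStructure (p : ℕ) (B : Type u) [CommRing B] where
  δ : B → B
  map_zero : δ 0 = 0
  map_one : δ 1 = 0
  map_mul : ∀ x y, δ (x * y) = x ^ p * δ y + y ^ p * δ x + (p : B) * δ x * δ y
  map_add : ∀ x y, δ (x + y) = δ x + δ y
    - ∑ i ∈ Finset.Ioo 0 p, ((p.choose i / p : ℕ) : B) * x ^ i * y ^ (p - i)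

/-- The `δ`-structure on the `A`-algebra `B` is compatible with the one on `A`. -/
def DeltaStructure.IsCompatible {p : ℕ} {A B : Type u} [CommRing A] [CommRing B] [Algebra A B]
    (δB : DeltaStructure p B) (δA : DeltaStructure p A) : Prop :=
  ∀ a : A, δB.δ (algebraMap A B a) = algebraMap A B (δA.δ a)

/-- The condition on (the underlying ring of) a `δ`-ring `B` for `(B, (p))` to be a crystalline
prism: `B` is `p`-torsion free and `p`-adically complete (and separated). -/
structure IsCrystalline (p : ℕ) (B : Type u) [CommRing B] : Prop where
  torsionFree : (p : B) ∈ nonZeroDivisors B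
  complete : IsAdicComplete (Ideal.span {(p : B)}) B

/-- `R` is a `p`-completely smooth `A`-algebra: it is `p`-adically complete and smooth modulo
each power of `p`, i.e. `Spf R → Spf A` is a smooth (affine) `p`-adic formal scheme. -/
structure IsPCompletelySmooth (p : ℕ) (A R : Type u) [CommRing A] [CommRing R] [Algebra A R] :
    Prop where
  complete : IsAdicComplete (Ideal.span {(p : R)}) R
  smooth : ∀ n : ℕ, Algebra.Smooth (A ⧸ Ideal.span {(p : A) ^ n})
    ((A ⧸ Ideal.span {(p : A) ^ n}) ⊗[A] R)

/-- A `p`-completely smooth algebra over a crystalline prism is `p`-torsion free. -/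
theorem IsPCompletelySmooth.isCrystalline {p : ℕ} {A R : Type u} [CommRing A] [CommRing R]
    [Algebra A R] (hA : IsCrystalline p A) (hR : IsPCompletelySmooth p A R) :
    IsCrystalline p R := by
  refine ⟨?_, hR.complete⟩
  rw [mem_nonZeroDivisors_iff_right]
  intro x hx
  have key : ∀ n : ℕ, x ∈ Ideal.span {(p : R)} ^ n := by
    intro n
    have := hR.smooth (n + 1)
    have hflat : Module.Flat (A ⧸ Ideal.span {(p : A) ^ (n + 1)})
      ((A ⧸ Ideal.span {(p : A) ^ (n + 1)}) ⊗[A] R) := inferInstance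
    have hrel : ((p : ℕ) : A ⧸ Ideal.span {(p : A) ^ (n + 1)}) •
        ((1 : A ⧸ Ideal.span {(p : A) ^ (n + 1)}) ⊗ₜ[A] x) = 0 := by
      rw [Nat.cast_smul_eq_nsmul, ← TensorProduct.tmul_smul, nsmul_eq_mul, mul_comm, hx,
        TensorProduct.tmul_zero]
    obtain ⟨κ, a, y, hy, ha⟩ := Module.Flat.isTrivialRelation_of_sum_smul_eq_zero
      (ι := Unit) (f := fun _ => ((p : ℕ) : A ⧸ Ideal.span {(p : A) ^ (n + 1)}))
      (x := fun _ => (1 : A ⧸ Ideal.span {(p : A) ^ (n + 1)}) ⊗ₜ[A] x) (by simpa using hrel)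
    have hxI : (Ideal.Quotient.mk (Ideal.span {(p : R) ^ n})) x = 0 := by
      let g₀ : (A ⧸ Ideal.span {(p : A) ^ (n + 1)}) →ₐ[A] R ⧸ Ideal.span {(p : R) ^ n} :=
        Ideal.Quotient.liftₐ _ (Algebra.ofId A _) (by
          intro b hb
          obtain ⟨c, rfl⟩ := Ideal.mem_span_singleton'.mp hb
          have h0 : (p : R ⧸ Ideal.span {(p : R) ^ n}) ^ n = 0 := by
            rw [← map_natCast (Ideal.Quotient.mk (Ideal.span {(p : R) ^ n})), ← map_pow,
              Ideal.Quotient.eq_zero_iff_mem]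
            exact Ideal.mem_span_singleton_self _
          simp [pow_succ, h0])
      let g : (A ⧸ Ideal.span {(p : A) ^ (n + 1)}) ⊗[A] R →ₐ[A] R ⧸ Ideal.span {(p : R) ^ n} :=
        Algebra.TensorProduct.lift g₀ (Ideal.Quotient.mkₐ A _) (fun _ _ => Commute.all _ _)
      have hg : g (1 ⊗ₜ x) = Ideal.Quotient.mk _ x := by
        simp [g]
      have hy' : (1 : A ⧸ Ideal.span {(p : A) ^ (n + 1)}) ⊗ₜ[A] x = ∑ j, a () j • y j := hy ()
      rw [← hg, hy', map_sum]
      refine Finset.sum_eq_zero fun j _ => ?_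
      have hsm : g (a () j • y j) = g₀ (a () j) * g (y j) := by
        refine (congrArg g (Algebra.smul_def (a () j) (y j))).trans ?_
        rw [map_mul]
        congr 1
        simp [g]
      rw [hsm]
      obtain ⟨b, hb⟩ := Ideal.Quotient.mk_surjective (a () j)
      have hpb : (p : A) * b ∈ Ideal.span {(p : A) ^ (n + 1)} := by
        rw [← Ideal.Quotient.eq_zero_iff_mem, map_mul, hb, map_natCast]
        simpa using ha j
      obtain ⟨c, hc⟩ := Ideal.mem_span_singleton'.mp hpb
      have hbc : b = c * (p : A) ^ n := by
        have h1 := (mem_nonZeroDivisors_iff_right.mp hA.torsionFree) (b - c * (p : A) ^ n) (by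
          rw [sub_mul, mul_comm b, ← hc]; ring)
        exact sub_eq_zero.mp h1
      have h0 : (p : R ⧸ Ideal.span {(p : R) ^ n}) ^ n = 0 := by
        rw [← map_natCast (Ideal.Quotient.mk (Ideal.span {(p : R) ^ n})), ← map_pow,
          Ideal.Quotient.eq_zero_iff_mem]
        exact Ideal.mem_span_singleton_self _
      have : g₀ (a () j) = 0 := by
        rw [← hb, hbc]
        simp [h0]
      rw [this, zero_mul]
    rw [Ideal.span_singleton_pow]
    exact Ideal.Quotient.eq_zero_iff_mem.mp hxI
  have := hR.complete.toIsHausdorff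
  exact IsHausdorff.haus this x fun n => by
    rw [SModEq.zero]
    simpa using key n

/-- Objects of the (affine) prismatic site of `R₀` over the crystalline prism `(A, (p))`:
`δ`-`A`-algebras `B` such that `(B, (p))` is a crystalline prism, together with a map of
`A`-algebras `R₀ → B / p`. (A map of prisms from `(A, (p))` to `(B, J)` forces `J = pB`.) -/
structure PrismOver (p : ℕ) {A : Type u} [CommRing A] (δA : DeltaStructure p A)
    (R₀ : Type u) [CommRing R₀] [Algebra A R₀] where
  carrier : Type u
  [commRing : CommRing carrier]
  [algebra : Algebra A carrier]
  delta : DeltaStructure p carrier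
  compat : delta.IsCompatible δA
  crystalline : IsCrystalline p carrier
  str : R₀ →ₐ[A] carrier ⧸ Ideal.span {(p : carrier)}

namespace PrismOver

attribute [instance] PrismOver.commRing PrismOver.algebra

variable {p : ℕ} {A : Type u} [CommRing A] {δA : DeltaStructure p A}
  {R₀ : Type u} [CommRing R₀] [Algebra A R₀]

/-- Reduction modulo `p` of a ring homomorphism. -/
def reduction (p : ℕ) {B C : Type u} [CommRing B] [CommRing C] (f : B →+* C) :
    B ⧸ Ideal.span {(p : B)} →+* C ⧸ Ideal.span {(p : C)} :=
  Ideal.quotientMap _ f (by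
    rw [Ideal.span_singleton_le_iff_mem, Ideal.mem_comap, map_natCast]
    exact Ideal.mem_span_singleton_self _)

/-- Morphisms, written in the direction of the ring homomorphisms: maps of `δ`-`A`-algebras
compatible with the structure maps from `R₀`. -/
@[ext]
structure Hom (B C : PrismOver p δA R₀) where
  toAlgHom : B.carrier →ₐ[A] C.carrier
  map_delta : ∀ x, toAlgHom (B.delta.δ x) = C.delta.δ (toAlgHom x)
  map_str : ∀ r, reduction p toAlgHom.toRingHom (B.str r) = C.str r

/-- The category of prisms over `R₀` relative to `(A, (p))`, in the direction of the ring
homomorphisms (the opposite of the category underlying the prismatic site). -/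
instance : Category (PrismOver p δA R₀) where
  Hom := Hom
  id B :=
    { toAlgHom := AlgHom.id A B.carrier
      map_delta := fun _ => rfl
      map_str := fun r => by
        obtain ⟨x, hx⟩ := Ideal.Quotient.mk_surjective (B.str r)
        rw [← hx]; rfl }
  comp {B C D} f g :=
    { toAlgHom := g.toAlgHom.comp f.toAlgHom
      map_delta := fun x => by
        rw [AlgHom.comp_apply, f.map_delta, g.map_delta, AlgHom.comp_apply]
      map_str := fun r => by
        rw [← g.map_str, ← f.map_str]
        obtain ⟨x, hx⟩ := Ideal.Quotient.mk_surjective (B.str r)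
        rw [← hx]; rfl }

/-- The ring homomorphism underlying a morphism of prisms. -/
def Hom.ringHom {B C : PrismOver p δA R₀} (f : B ⟶ C) : B.carrier →+* C.carrier :=
  (Hom.toAlgHom f).toRingHom

/-- The functor `(B, (p)) ↦ B`. -/
def forgetToRing : PrismOver p δA R₀ ⥤ CommRingCat.{u} where
  obj B := CommRingCat.of B.carrier
  map f := CommRingCat.ofHom (Hom.ringHom f)

/-- The prism `(R, (p), δ)` given by a `δ`-structure `δR` on a `p`-completely smooth lifting
`R` of `R₀`. -/
def ofLift {R : Type u} [CommRing R] [Algebra A R]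
    (hA : IsCrystalline p A) (hR : IsPCompletelySmooth p A R)
    (red : (R ⧸ Ideal.span {(p : R)}) ≃ₐ[A] R₀)
    (δR : DeltaStructure p R) (hδ : δR.IsCompatible δA) : PrismOver p δA R₀ where
  carrier := R
  delta := δR
  compat := hδ
  crystalline := hR.isCrystalline hA
  str := red.symm.toAlgHom

end PrismOver

section Nerves

variable {C : Type*} [Category C]

/-- The cosimplicial object `[n] ↦ X ⨿ ⋯ ⨿ X` (`n + 1` copies). -/
noncomputable def selfNerve (X : C) (h : ∀ n : ℕ, HasCoproduct (fun _ : Fin (n + 1) => X)) :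
    CosimplicialObject C where
  obj n := haveI := h n.len; ∐ (fun _ : Fin (n.len + 1) => X)
  map {m n} f :=
    haveI := h m.len; haveI := h n.len
    Sigma.desc fun i => Sigma.ι (fun _ : Fin (n.len + 1) => X) (f.toOrderHom i)
  map_id n := by
    have := h n.len
    apply Sigma.hom_ext
    intro i
    simp
  map_comp {l m n} f g := by
    have := h l.len; have := h m.len; have := h n.len
    apply Sigma.hom_ext
    intro i
    simp

/-- The coprojection of the `(j + 1)`-th copy of `X` into the `n`-th term of the nerve. -/
noncomputable def selfNerveι (X : C) (h : ∀ n : ℕ, HasCoproduct (fun _ : Fin (n + 1) => X))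
    (n : ℕ) (j : Fin (n + 1)) : X ⟶ (selfNerve X h).obj (SimplexCategory.mk n) :=
  haveI := h n
  Sigma.ι (fun _ : Fin (n + 1) => X) j

/-- The family consisting of one copy of `P` and `n + 1` copies of `X`. -/
def mixedFamily (P X : C) (n : ℕ) : Option (Fin (n + 1)) → C
  | none => P
  | some _ => X

/-- The maps which send `P` identically to `P` and the `(j + 1)`-th copy of `X` identically to
the `(f j + 1)`-th one. -/
noncomputable def mixedLeg (P X : C) {m : ℕ} (n : ℕ) [HasCoproduct (mixedFamily P X n)]
    (f : Fin (m + 1) → Fin (n + 1)) : ∀ i, mixedFamily P X m i ⟶ ∐ (mixedFamily P X n)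
  | none => Sigma.ι (mixedFamily P X n) none
  | some j => Sigma.ι (mixedFamily P X n) (some (f j))

/-- The cosimplicial object `[n] ↦ P ⨿ X ⨿ ⋯ ⨿ X` (one copy of `P`, `n + 1` copies of `X`);
the cosimplicial structure maps act on the copies of `X`. -/
noncomputable def mixedNerve (P X : C) (h : ∀ n : ℕ, HasCoproduct (mixedFamily P X n)) :
    CosimplicialObject C where
  obj n := haveI := h n.len; ∐ (mixedFamily P X n.len)
  map {m n} f :=
    haveI := h m.len; haveI := h n.len
    Sigma.desc (mixedLeg P X n.len f.toOrderHom)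
  map_id n := by
    have := h n.len
    apply Sigma.hom_ext
    rintro (_ | i)
    · simp [mixedLeg]
    · simp [mixedLeg]
  map_comp {l m n} f g := by
    have := h l.len
    have := h m.len
    have := h n.len
    apply Sigma.hom_ext
    rintro (_ | i)
    · simp only [Sigma.ι_desc, Sigma.ι_desc_assoc]
      exact (Sigma.ι_desc (mixedLeg P X n.len g.toOrderHom) none).symm
    · simp only [Sigma.ι_desc, Sigma.ι_desc_assoc]
      exact (Sigma.ι_desc (mixedLeg P X n.len g.toOrderHom) (some (f.toOrderHom i))).symm

/-- The coprojection of `P` into the `n`-th term of the mixed nerve. -/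
noncomputable def mixedNerveBase (P X : C) (h : ∀ n : ℕ, HasCoproduct (mixedFamily P X n))
    (n : ℕ) : P ⟶ (mixedNerve P X h).obj (SimplexCategory.mk n) :=
  haveI := h n
  Sigma.ι (mixedFamily P X n) none

/-- The coprojection of the `(j + 1)`-th copy of `X` into the `n`-th term of the mixed nerve. -/
noncomputable def mixedNerveι (P X : C) (h : ∀ n : ℕ, HasCoproduct (mixedFamily P X n))
    (n : ℕ) (j : Fin (n + 1)) : X ⟶ (mixedNerve P X h).obj (SimplexCategory.mk n) :=
  haveI := h n
  Sigma.ι (mixedFamily P X n) (some j)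

end Nerves

section PDPolynomials

/-- The `p`-complete free pd-algebra `R[X_s : s ∈ σ]^∧_pd`: the `p`-adic completion of the
divided power algebra of the free `R`-module on `σ`. -/
abbrev PDPoly (p : ℕ) (R : Type u) [CommRing R] (σ : Type) : Type u :=
  AdicCompletion (Ideal.span {(p : DividedPowerAlgebra R (σ →₀ R))})
    (DividedPowerAlgebra R (σ →₀ R))

/-- The variable `X_s` of the `p`-complete free pd-algebra. -/
noncomputable def PDPoly.X (p : ℕ) (R : Type u) [CommRing R] {σ : Type} (s : σ) :
    PDPoly p R σ :=
  algebraMap (DividedPowerAlgebra R (σ →₀ R)) _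
    (DividedPowerAlgebra.embed R (σ →₀ R) (Finsupp.single s 1))

/-- `R[X_1, …, X_n]^∧_pd`, where each `X_j` stands for `d` variables `X_{j,1}, …, X_{j,d}`. -/
abbrev PDModel (p : ℕ) (R : Type u) [CommRing R] (d n : ℕ) : Type u :=
  PDPoly p R (Fin n × Fin d)

/-- The variable `X_{j,k}` of `R[X_1, …, X_n]^∧_pd` for `1 ≤ j ≤ n` (and `0` for other `j`). -/
noncomputable def pdVar (p : ℕ) (R : Type u) [CommRing R] (d n j : ℕ) (k : Fin d) :
    PDModel p R d n :=
  if h : 1 ≤ j ∧ j ≤ n then PDPoly.X p R (⟨j - 1, by omega⟩, k) else 0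

/-- The values of the `i`-th face map `R[X_1, …, X_n]^∧_pd → R[X_1, …, X_{n+1}]^∧_pd` on the
variables. -/
def FaceOnVars (p : ℕ) (R : Type u) [CommRing R] (d n : ℕ) (i : Fin (n + 2))
    (f : PDModel p R d n →+* PDModel p R d (n + 1)) : Prop :=
  ∀ (j : ℕ) (k : Fin d), 1 ≤ j → j ≤ n →
    f (pdVar p R d n j k) =
      if (i : ℕ) = 0 then pdVar p R d (n + 1) (j + 1) k - pdVar p R d (n + 1) 1 k
      else if (i : ℕ) ≤ j then pdVar p R d (n + 1) (j + 1) k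
      else pdVar p R d (n + 1) j k

/-- The description of the `i`-th face map for the self-nerve of `R`. For `i ≥ 1` it is
`R`-linear. The `0`-th one is determined on `R` by being `A`-linear, by reducing modulo `p` to
the structure map, and by `T ↦ T - p X_1` on the coordinates. -/
structure IsSelfFace (p : ℕ) (A : Type u) {R : Type u} [CommRing A] [CommRing R] [Algebra A R]
    {d : ℕ} (T : Fin d → R) (n : ℕ) (i : Fin (n + 2))
    (f : PDModel p R d n →+* PDModel p R d (n + 1)) : Prop where
  onBase_succ : (i : ℕ) ≠ 0 → ∀ r : R, f (algebraMap R _ r) = algebraMap R _ r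
  onBase_zero_linear : (i : ℕ) = 0 → ∀ a : A,
    f (algebraMap R _ (algebraMap A R a)) = algebraMap R _ (algebraMap A R a)
  onBase_zero_mod : (i : ℕ) = 0 → ∀ r : R,
    f (algebraMap R _ r) - algebraMap R _ r ∈ Ideal.span {(p : PDModel p R d (n + 1))}
  onCoord_zero : (i : ℕ) = 0 → ∀ k : Fin d,
    f (algebraMap R _ (T k)) = algebraMap R _ (T k) - (p : PDModel p R d (n + 1)) *
      pdVar p R d (n + 1) 1 k
  onVars : FaceOnVars p R d n i f

/-- The description of the `i`-th degeneracy map: it is linear over the base ring and has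
prescribed values on the variables. -/
structure IsDegeneracy (p : ℕ) (R : Type u) [CommRing R] (d n : ℕ) (i : Fin (n + 1))
    (f : PDModel p R d (n + 1) →+* PDModel p R d n) : Prop where
  onBase : ∀ r : R, f (algebraMap R _ r) = algebraMap R _ r
  onVars : ∀ (j : ℕ) (k : Fin d), 1 ≤ j → j ≤ n + 1 →
    f (pdVar p R d (n + 1) j k) =
      if (i : ℕ) = 0 ∧ j = 1 then 0
      else if (i : ℕ) < j then pdVar p R d n (j - 1) k
      else pdVar p R d n j k

/-- The description of the `i`-th face map for the mixed nerve; here `R₁₂` is an algebra over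
`R₁` via `inl`, with elements `Y_1, …, Y_d`. -/
structure IsMixedFace (p : ℕ) {R₁ R₁₂ : Type u} [CommRing R₁] [CommRing R₁₂]
    (inl : R₁ →+* R₁₂) {d : ℕ} (Y : Fin d → R₁₂) (n : ℕ) (i : Fin (n + 2))
    (f : PDModel p R₁₂ d n →+* PDModel p R₁₂ d (n + 1)) : Prop where
  onBase : ∀ r : R₁, f (algebraMap R₁₂ _ (inl r)) = algebraMap R₁₂ _ (inl r)
  onY : ∀ k : Fin d, f (algebraMap R₁₂ _ (Y k)) =
    if (i : ℕ) = 0 then algebraMap R₁₂ _ (Y k) + pdVar p R₁₂ d (n + 1) 1 k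
    else algebraMap R₁₂ _ (Y k)
  onVars : FaceOnVars p R₁₂ d n i f

/-- A cosimplicial ring with prescribed terms `S 0, S 1, …`. -/
structure CosimplicialStructure (S : ℕ → Type u) [∀ n, CommRing (S n)] where
  map : ∀ {m n : SimplexCategory}, (m ⟶ n) → (S m.len →+* S n.len)
  map_id : ∀ n : SimplexCategory, map (𝟙 n) = RingHom.id _
  map_comp : ∀ {l m n : SimplexCategory} (f : l ⟶ m) (g : m ⟶ n),
    map (f ≫ g) = (map g).comp (map f)

namespace CosimplicialStructure

variable {S : ℕ → Type u} [∀ n, CommRing (S n)] (M : CosimplicialStructure S)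

/-- The cosimplicial ring as a cosimplicial object. -/
def toCosimplicialObject : CosimplicialObject CommRingCat.{u} where
  obj n := CommRingCat.of (S n.len)
  map f := CommRingCat.ofHom (M.map f)
  map_id n := by rw [M.map_id]; rfl
  map_comp f g := by rw [M.map_comp]; rfl

/-- The face map `p_i`, induced by the injection `[n] → [n + 1]` omitting `i`. -/
def face (n : ℕ) (i : Fin (n + 2)) : S n →+* S (n + 1) :=
  M.map (SimplexCategory.δ i)

/-- The degeneracy map `σ_i`, induced by the surjection `[n + 1] → [n]` hitting `i` twice. -/
def degeneracy (n : ℕ) (i : Fin (n + 1)) : S (n + 1) →+* S n :=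
  M.map (SimplexCategory.σ i)

/-- The `n`-th component, as a ring homomorphism, of a morphism to the cosimplicial ring
underlying a cosimplicial prism. -/
def component {p : ℕ} {A : Type u} [CommRing A] {δA : DeltaStructure p A}
    {R₀ : Type u} [CommRing R₀] [Algebra A R₀] {N : CosimplicialObject (PrismOver p δA R₀)}
    (e : M.toCosimplicialObject ⟶ N ⋙ PrismOver.forgetToRing) (n : ℕ) :
    S n →+* (N.obj (SimplexCategory.mk n)).carrier :=
  (e.app (SimplexCategory.mk n)).hom

end CosimplicialStructure

end PDPolynomials

/-! On a `p`-torsion free ring a `δ`-structure is the same as a Frobenius lift `φ`, and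
compatibility of a ring map with `δ` can be tested on `φ`. Let `f, f'` be maps from two of the given
lifts to one prism `B` over `R₀`. Both reduce to the structure map of `B`, so `y = (f T - f' T) / p`
exists. As the two `δ`-structures agree modulo `p`, the elements `f (φ T)` and `f' (φ' T)` agree
modulo `p²` (`sq_dvd_map_frobenius_sub`). Hence `p ∣ φ y`, and this forces `y` to have all divided
powers (`hasDividedPowers_of_dvd_frobenius`). A prism receiving several copies of `R` therefore
receives a map from a `p`-complete free pd-algebra `D` over the first copy.

Conversely, `D` is such a prism. Étaleness of the coordinates gives the remaining legs `R → D` with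
`T ↦ T - p w_j`. The Frobenius is forced to be `w ↦ p u` for certain `u`, and it lifts Frobenius
because `φ (w^[n])` and `(w^[n])^p` are both divisible by `p` for `n > 0`, by valuations of
factorials (`PDPoly.dvd_sub_pow`). So `D` is the coproduct (`exists_coproduct_of_isPDPoly`).

Two universal properties, both tested on `p`-torsion free `p`-complete rings, carry the argument.
`IsPDPoly` characterises the pd-algebra; it rests on the torsion-freeness of the free divided power
algebra. `IsEtaleCoordinates` says that maps out of `R` are given by their reduction modulo `p` and
their values on `T`; it is proved one power of `p` at a time, the obstruction at each stage being a
derivation in characteristic `p`.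

The cosimplicial formulas are then linear algebra. With `X_0 = 0` and `p X_j = T_0 - T_j`, a map `θ`
in the simplex category sends `X_j` to `X_{θ j} - X_{θ 0}`. In the mixed nerve `θ` sends `w_j = (T -
S_j) / p` to `w_{θ j}`, and one rewrites this in the variables `Y = w_0` and `Z_j = w_j - w_0`. The
universal properties also show that the listed properties determine the structure maps. -/

section DividedPowers

open scoped Nat

/-! ### Integers and factorials in `p`-torsion free `p`-complete rings. -/

namespace IsCrystalline

variable {p : ℕ} {B : Type u} [CommRing B] (hB : IsCrystalline p B)
include hB

theorem p_cancel {x y : B} (h : (p : B) * x = p * y) : x = y :=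
  (mul_cancel_left_mem_nonZeroDivisors hB.torsionFree).mp h

theorem pow_mem_nonZeroDivisors (n : ℕ) : (p : B) ^ n ∈ nonZeroDivisors B :=
  pow_mem hB.torsionFree n

theorem eq_of_forall_pow_dvd_sub {x y : B} (h : ∀ n, (p : B) ^ n ∣ x - y) : x = y := by
  have := hB.complete.toIsHausdorff
  refine sub_eq_zero.mp (IsHausdorff.haus this _ fun n => ?_)
  rw [SModEq.zero, smul_eq_mul, Ideal.mul_top, Ideal.span_singleton_pow,
    Ideal.mem_span_singleton]
  exact h n

theorem isUnit_of_isUnit_mk {x : B}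
    (hx : IsUnit (Ideal.Quotient.mk (Ideal.span {(p : B)}) x)) : IsUnit x := by
  have := hB.complete
  have hle : Ideal.span {(p : B)} ≤ (⊥ : Ideal B).jacobson := IsAdicComplete.le_jacobson_bot _
  obtain ⟨y, hy⟩ := hx.exists_right_inv
  obtain ⟨y, rfl⟩ := Ideal.Quotient.mk_surjective y
  rw [← map_mul, ← map_one (Ideal.Quotient.mk _), Ideal.Quotient.eq] at hy
  have h := Ideal.mem_jacobson_bot.mp (hle hy) 1
  rw [mul_one, sub_add_cancel] at h
  exact isUnit_of_mul_isUnit_left h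

theorem isUnit_natCast {m : ℕ} (hm : m.Coprime p) : IsUnit (m : B) := by
  apply hB.isUnit_of_isUnit_mk
  have h : (m : ℤ) * Nat.gcdA m p + p * Nat.gcdB m p = 1 := by
    rw [← Nat.gcd_eq_gcd_ab, hm]; rfl
  have h' := congrArg (fun z : ℤ => Ideal.Quotient.mk (Ideal.span {(p : B)}) (z : B)) h
  simp only [Int.cast_add, Int.cast_mul, Int.cast_natCast, Int.cast_one, map_add, map_mul,
    map_one] at h'
  rw [Ideal.Quotient.eq_zero_iff_mem.mpr (Ideal.mem_span_singleton_self (p : B)), zero_mul,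
    add_zero] at h'
  exact IsUnit.of_mul_eq_one _ h'

variable [Fact p.Prime]

/-- Integers prime to `p` are units, because `p` lies in the Jacobson radical. Divisibility between
nonzero integers thus becomes a comparison of `p`-adic valuations. -/
theorem exists_natCast_eq {m : ℕ} (hm : m ≠ 0) :
    ∃ w : B, IsUnit w ∧ (m : B) = p ^ padicValNat p m * w := by
  obtain ⟨k, hk⟩ := pow_padicValNat_dvd (p := p) (n := m)
  refine ⟨(k : B), hB.isUnit_natCast ?_, by exact_mod_cast congrArg (Nat.cast : ℕ → B) hk⟩
  rw [Nat.coprime_comm, (Fact.out : p.Prime).coprime_iff_not_dvd]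
  rintro ⟨l, rfl⟩
  exact pow_succ_padicValNat_not_dvd (p := p) hm ⟨l, by rw [pow_succ, mul_assoc]; exact hk⟩

theorem natCast_dvd_natCast {m n : ℕ} (hm : m ≠ 0) (hn : n ≠ 0)
    (h : padicValNat p m ≤ padicValNat p n) : (m : B) ∣ n := by
  obtain ⟨w, hw, hmw⟩ := hB.exists_natCast_eq hm
  obtain ⟨v, -, hnv⟩ := hB.exists_natCast_eq hn
  rw [hmw, hnv, hw.mul_right_dvd]
  exact (pow_dvd_pow _ h).mul_right _

theorem natCast_mem_nonZeroDivisors {m : ℕ} (hm : m ≠ 0) : (m : B) ∈ nonZeroDivisors B := by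
  obtain ⟨w, hw, hmw⟩ := hB.exists_natCast_eq hm
  rw [hmw]
  exact mul_mem (hB.pow_mem_nonZeroDivisors _) hw.mem_nonZeroDivisors

/-- The valuation of `n!` is strictly less than `n`. The spare factor `p` is what makes `φ x ^ n /
n!` divisible by `p` when `φ x` is. -/
theorem factorial_mul_dvd_pow {n : ℕ} (hn : n ≠ 0) : ((n ! * p : ℕ) : B) ∣ (p : B) ^ n := by
  rw [← Nat.cast_pow]
  have hp := (Fact.out : p.Prime)
  apply hB.natCast_dvd_natCast (mul_ne_zero n.factorial_ne_zero hp.ne_zero)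
    (pow_ne_zero _ hp.ne_zero)
  rw [padicValNat.mul n.factorial_ne_zero hp.ne_zero, padicValNat_self, padicValNat.prime_pow]
  exact padicValNat_factorial_lt_of_ne_zero p hn

theorem factorial_dvd_pow (n : ℕ) : (n ! : B) ∣ (p : B) ^ n := by
  rcases eq_or_ne n 0 with rfl | hn
  · simp
  · exact (Dvd.intro (p : B) (by push_cast; rfl)).trans (hB.factorial_mul_dvd_pow hn)

/-- With `v` the valuation of `n!`, that of `(p n)!` is `n + v`, and Legendre's bound `(p - 1) v <
n` gives `p v + 1 ≤ n + v`. This yields `p ∣ (x^[n])^p`. -/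
theorem factorial_pow_mul_dvd_factorial {n : ℕ} (hn : n ≠ 0) :
    ((n ! ^ p * p : ℕ) : B) ∣ ((p * n)! : ℕ) := by
  have hp := (Fact.out : p.Prime)
  apply hB.natCast_dvd_natCast (mul_ne_zero (pow_ne_zero _ n.factorial_ne_zero) hp.ne_zero)
    (Nat.factorial_ne_zero _)
  rw [padicValNat.mul (pow_ne_zero _ n.factorial_ne_zero) hp.ne_zero, padicValNat_self,
    padicValNat.pow, padicValNat_factorial_mul]
  have h := sub_one_mul_padicValNat_factorial_lt_of_ne_zero p hn
  obtain ⟨q, hq⟩ : ∃ q, p = q + 1 := ⟨p - 1, (Nat.succ_pred hp.ne_zero).symm⟩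
  rw [hq] at h ⊢
  simp only [Nat.add_sub_cancel] at h
  rw [add_mul, one_mul]
  omega

end IsCrystalline

/-- All divided powers `x ^ n / n!` of `x` exist. -/
def HasDividedPowers {B : Type u} [CommRing B] (x : B) : Prop :=
  ∀ n : ℕ, (n ! : B) ∣ x ^ n

namespace HasDividedPowers

variable {B C : Type u} [CommRing B] [CommRing C] {x y : B}

theorem map (hx : HasDividedPowers x) (f : B →+* C) : HasDividedPowers (f x) := fun n => by
  simpa using map_dvd f (hx n)

theorem zero : HasDividedPowers (0 : B) := fun n => by
  cases n <;> simp

theorem mul_left (hx : HasDividedPowers x) (b : B) : HasDividedPowers (b * x) := fun n => by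
  rw [mul_pow]
  exact (hx n).mul_left _

theorem neg (hx : HasDividedPowers x) : HasDividedPowers (-x) := by
  simpa using hx.mul_left (-1)

theorem add (hx : HasDividedPowers x) (hy : HasDividedPowers y) :
    HasDividedPowers (x + y) := fun n => by
  rw [add_pow]
  refine Finset.dvd_sum fun i hi => ?_
  have hi' : i ≤ n := Nat.lt_succ_iff.mp (Finset.mem_range.mp hi)
  rw [← Nat.choose_mul_factorial_mul_factorial hi', mul_assoc (n.choose i),
    Nat.cast_mul, Nat.cast_mul]
  rw [mul_comm (n.choose i : B)]
  exact mul_dvd_mul_right (mul_dvd_mul (hx i) (hy (n - i))) _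

theorem sub (hx : HasDividedPowers x) (hy : HasDividedPowers y) :
    HasDividedPowers (x - y) := by
  simpa [sub_eq_add_neg] using hx.add hy.neg

theorem sum {ι : Type*} (s : Finset ι) {f : ι → B} (h : ∀ i ∈ s, HasDividedPowers (f i)) :
    HasDividedPowers (∑ i ∈ s, f i) := by
  classical
  induction s using Finset.induction_on with
  | empty => simpa using zero
  | insert a s ha ih =>
    rw [Finset.sum_insert ha]
    exact (h a (Finset.mem_insert_self _ _)).add
      (ih fun i hi => h i (Finset.mem_insert_of_mem hi))

end HasDividedPowers

theorem IsCrystalline.hasDividedPowers_mul {p : ℕ} [Fact p.Prime] {B : Type u} [CommRing B]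
    (hB : IsCrystalline p B) (x : B) : HasDividedPowers ((p : B) * x) := fun n => by
  rw [mul_pow]
  exact (hB.factorial_dvd_pow n).mul_right _

/-! ### `δ`-structures as Frobenius lifts, and divided powers obtained from Frobenius. -/

namespace DeltaStructure

variable {p : ℕ} [Fact p.Prime] {B C : Type u} [CommRing B] [CommRing C]

theorem add_pow_eq (x y : B) : (x + y) ^ p = x ^ p + y ^ p +
    p * ∑ i ∈ Finset.Ioo 0 p, ((p.choose i / p : ℕ) : B) * x ^ i * y ^ (p - i) := by
  have hp := (Fact.out : p.Prime)
  rw [add_pow, Finset.sum_range_succ, Finset.range_eq_Ico,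
    ← Finset.add_sum_Ioo_eq_sum_Ico hp.pos, Finset.mul_sum]
  have h : ∀ i ∈ Finset.Ioo 0 p, x ^ i * y ^ (p - i) * (p.choose i : B) =
      p * (((p.choose i / p : ℕ) : B) * x ^ i * y ^ (p - i)) := fun i hi => by
    rw [Finset.mem_Ioo] at hi
    have hd : p * (p.choose i / p) = p.choose i :=
      Nat.mul_div_cancel' (hp.dvd_choose_self hi.1.ne' hi.2)
    conv_lhs => rw [← hd, Nat.cast_mul]
    ring
  rw [Finset.sum_congr rfl h]
  simp
  ring

/-- The Frobenius lift of a `δ`-structure. -/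
def frobenius (δ : DeltaStructure p B) : B →+* B where
  toFun x := x ^ p + p * δ.δ x
  map_zero' := by simp [δ.map_zero, (Fact.out : p.Prime).ne_zero]
  map_one' := by simp [δ.map_one]
  map_add' x y := by
    rw [δ.map_add, add_pow_eq]
    ring
  map_mul' x y := by
    rw [δ.map_mul]
    ring

theorem frobenius_apply (δ : DeltaStructure p B) (x : B) :
    δ.frobenius x = x ^ p + p * δ.δ x := rfl

/-- Unlike `δ`, the map `φ` is a ring homomorphism, so after this translation compatibility can be
checked on generators. -/
theorem map_delta_iff (hC : IsCrystalline p C) (δB : DeltaStructure p B)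
    (δC : DeltaStructure p C) (f : B →+* C) (x : B) :
    f (δB.δ x) = δC.δ (f x) ↔ f (δB.frobenius x) = δC.frobenius (f x) := by
  simp only [frobenius_apply, _root_.map_add, map_pow, _root_.map_mul, map_natCast, add_right_inj]
  exact ⟨fun h => by rw [h], hC.p_cancel⟩

/-- The `δ`-structure on a `p`-torsion free ring given by a Frobenius lift. -/
noncomputable def ofFrobenius (hB : IsCrystalline p B) (F : B →+* B)
    (h : ∀ x, (p : B) ∣ F x - x ^ p) : DeltaStructure p B where
  δ x := (h x).choose
  map_zero := hB.p_cancel <| by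
    rw [← (h 0).choose_spec]
    simp [(Fact.out : p.Prime).ne_zero]
  map_one := hB.p_cancel <| by
    rw [← (h 1).choose_spec]
    simp
  map_mul x y := hB.p_cancel <| by
    rw [← (h (x * y)).choose_spec, _root_.map_mul]
    linear_combination (F x) * (h y).choose_spec + y ^ p * (h x).choose_spec +
      p * (h y).choose * (h x).choose_spec
  map_add x y := hB.p_cancel <| by
    rw [← (h (x + y)).choose_spec, _root_.map_add]
    linear_combination (h x).choose_spec + (h y).choose_spec - add_pow_eq (p := p) x y

theorem frobenius_ofFrobenius (hB : IsCrystalline p B) (F : B →+* B)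
    (h : ∀ x, (p : B) ∣ F x - x ^ p) : (ofFrobenius hB F h).frobenius = F := by
  ext x
  change x ^ p + p * (h x).choose = F x
  linear_combination -(h x).choose_spec

/-- Here `x ^ p = φ x - p δ x = p z`, and `p φ z = φ x ^ p` is divisible by `p ^ p`, so `z` again
satisfies the hypothesis, as `p ≥ 2`. Writing `n = p m + r` with `r < p` gives `x ^ n = p ^ m z ^ m
x ^ r`, while `n!` has the valuation of `p ^ m m!`; induction applies to `z` and `m`. -/
theorem hasDividedPowers_of_dvd_frobenius (hB : IsCrystalline p B) (δ : DeltaStructure p B)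
    {x : B} (hx : (p : B) ∣ δ.frobenius x) : HasDividedPowers x := by
  have hp := (Fact.out : p.Prime)
  intro n
  induction n using Nat.strong_induction_on generalizing x with
  | _ n ih =>
  rcases lt_or_ge n p with hn | hn
  · apply IsUnit.dvd
    exact hB.isUnit_natCast (Nat.coprime_comm.mp (hp.coprime_factorial_of_lt hn))
  obtain ⟨z, hz⟩ : (p : B) ∣ x ^ p := by
    rw [eq_sub_iff_add_eq.mpr (δ.frobenius_apply x).symm]
    exact dvd_sub hx (dvd_mul_right _ _)
  have hFz : (p : B) ∣ δ.frobenius z := by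
    obtain ⟨w, hw⟩ := hx
    refine ⟨(p : B) ^ (p - 2) * w ^ p, hB.p_cancel ?_⟩
    have : (p : B) * δ.frobenius z = δ.frobenius x ^ p := by
      rw [← map_pow, hz, _root_.map_mul, map_natCast]
    rw [this, hw, mul_pow]
    obtain ⟨q, hq⟩ : ∃ q, p = q + 2 := ⟨p - 2, (Nat.sub_add_cancel hp.two_le).symm⟩
    rw [show p - 2 = q by omega]
    have h3 : (p : B) ^ p = p * (p * p ^ q) := by
      conv_lhs => rw [show ((p : B) ^ p) = (p : B) ^ (q + 2) by rw [← hq]]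
      ring
    rw [h3]
    ring
  have hlt : n / p < n := Nat.div_lt_self (hp.pos.trans_le hn) hp.one_lt
  have key := ih (n / p) hlt hFz
  have hdvd : (n ! : B) ∣ ((p ^ (n / p) * (n / p)! : ℕ) : B) := by
    apply hB.natCast_dvd_natCast n.factorial_ne_zero
      (mul_ne_zero (pow_ne_zero _ hp.ne_zero) (Nat.factorial_ne_zero _))
    rw [padicValNat.mul (pow_ne_zero _ hp.ne_zero) (Nat.factorial_ne_zero _),
      padicValNat.prime_pow]
    conv_lhs => rw [← Nat.div_add_mod n p]
    rw [padicValNat_factorial_mul_add _ (Nat.mod_lt _ hp.pos), padicValNat_factorial_mul,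
      add_comm]
  refine hdvd.trans ?_
  have : x ^ n = (p : B) ^ (n / p) * z ^ (n / p) * x ^ (n % p) := by
    conv_lhs => rw [← Nat.div_add_mod n p]
    rw [pow_add, pow_mul, hz, mul_pow]
  rw [this]
  push_cast
  exact (mul_dvd_mul_left _ key).mul_right _

end DeltaStructure

/-! ### Maps out of the free divided power algebra, and its torsion-freeness. -/

namespace DividedPowerAlgebra

variable {R B : Type u} [CommRing R] [CommRing B] {σ : Type}

/-- Since factorials are nonzerodivisors, the quotients `l m ^ n / n!` are unique, and every divided
power axiom follows by clearing denominators. -/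
theorem exists_ringHom (hB : ∀ n : ℕ, (n ! : B) ∈ nonZeroDivisors B) (g : R →+* B) (y : σ → B)
    (hy : ∀ s, HasDividedPowers (y s)) :
    ∃ h : DividedPowerAlgebra R (σ →₀ R) →+* B, (∀ r, h (algebraMap R _ r) = g r) ∧
      ∀ s, h (embed R (σ →₀ R) (Finsupp.single s 1)) = y s := by
  let _ := g.toAlgebra
  let l : (σ →₀ R) →ₗ[R] B := Finsupp.linearCombination R y
  have hl : ∀ m n, ∃ z : B, l m ^ n = n ! * z := fun m => by
    change HasDividedPowers (l m)
    rw [Finsupp.linearCombination_apply]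
    refine HasDividedPowers.sum _ fun s _ => ?_
    change HasDividedPowers (g (m s) * y s)
    exact (hy s).mul_left _
  choose f hf using hl
  have cancel : ∀ (n : ℕ) {a b : B}, (n ! : B) * a = n ! * b → a = b := fun n _ _ h =>
    (mul_cancel_left_mem_nonZeroDivisors (hB n)).mp h
  let F := DividedPowerAlgebra.lift' (R := R) (A := B) (f := fun q : ℕ × (σ →₀ R) => f q.2 q.1)
    (fun m => cancel 0 (by rw [← hf]; simp))
    (fun n r m => cancel n (by
      rw [← hf, map_smul, smul_pow, hf, mul_smul_comm]))
    (fun n q m => cancel n (cancel q (by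
      have h : (((n + q).choose n * n ! * q ! : ℕ) : B) * f m (n + q) = l m ^ (n + q) := by
        rw [hf, Nat.choose_symm_add, Nat.add_choose_mul_factorial_mul_factorial]
      rw [pow_add, hf m n, hf m q] at h
      push_cast at h
      rw [nsmul_eq_mul]
      linear_combination -h)))
    (fun n u v => cancel n (by
      rw [← hf, map_add, (Commute.all (l u) (l v)).add_pow', Finset.mul_sum]
      refine Finset.sum_congr rfl fun k hk => ?_
      have hk' := Finset.HasAntidiagonal.mem_antidiagonal.mp hk
      rw [hf, hf, nsmul_eq_mul, ← hk', Nat.choose_symm_add, ← Nat.add_choose_mul_factorial_mul_factorial]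
      push_cast
      ring))
  have hone : ∀ m, f m 1 = l m := fun m => by simpa using (hf m 1).symm
  refine ⟨F.toRingHom, fun r => F.commutes r, fun s => ?_⟩
  change F (dp R 1 _) = _
  rw [lift'_apply_dp]
  simp [hone, l]

theorem ringHom_ext (hB : ∀ n : ℕ, (n ! : B) ∈ nonZeroDivisors B)
    {h h' : DividedPowerAlgebra R (σ →₀ R) →+* B}
    (h₁ : ∀ r, h (algebraMap R _ r) = h' (algebraMap R _ r))
    (h₂ : ∀ s, h (embed R (σ →₀ R) (Finsupp.single s 1)) =
      h' (embed R (σ →₀ R) (Finsupp.single s 1))) : h = h' := by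
  have hemb : ∀ m, h (embed R (σ →₀ R) m) = h' (embed R (σ →₀ R) m) := fun m => by
    induction m using Finsupp.induction_linear with
    | zero => simp
    | add u v hu hv => simp only [map_add, hu, hv]
    | single s r =>
      rw [← mul_one r, ← smul_eq_mul, ← Finsupp.smul_single, map_smul, Algebra.smul_def,
        map_mul, map_mul, h₁, h₂]
  have hdp : ∀ n m, h (dp R n m) = h' (dp R n m) := fun n m =>
    (mul_cancel_left_mem_nonZeroDivisors (hB n)).mp <| by
      rw [← map_natCast h, ← map_mul, natFactorial_mul_dp_eq, map_natCast, ← map_natCast h',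
        ← map_mul, natFactorial_mul_dp_eq, map_pow, map_pow, ← embed_def, hemb]
  refine RingHom.ext fun x => ?_
  induction x using DividedPowerAlgebra.induction_on with
  | C a => exact h₁ a
  | add f g hf hg => rw [map_add, map_add, hf, hg]
  | dp f n m hf => rw [map_mul, map_mul, hf, hdp]

/-- The products of divided powers of the variables span, and in `R[1/p][X]` they become unit
multiples of distinct monomials. As `R` embeds in `R[1/p]`, the algebra embeds in a ring where `p`
is invertible. -/
theorem natCast_mem_nonZeroDivisors {p : ℕ} [Fact p.Prime] (hR : IsCrystalline p R) :
    (p : DividedPowerAlgebra R (σ →₀ R)) ∈ nonZeroDivisors _ := by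
  classical
  let L := Localization.Away (p : R)
  have hpL : IsUnit (p : L) := by
    simpa using IsLocalization.Away.algebraMap_isUnit (S := L) (p : R)
  have hinj : Function.Injective (algebraMap R L) := IsLocalization.injective L
    ((Submonoid.powers_le (P := nonZeroDivisors R)).mpr hR.torsionFree)
  have hfac : ∀ n : ℕ, IsUnit (n ! : L) := fun n => by
    obtain ⟨w, hw, h⟩ := hR.exists_natCast_eq n.factorial_ne_zero
    rw [← map_natCast (algebraMap R L), h]
    simpa using (hpL.pow _).mul (hw.map (algebraMap R L))
  have hfac' : ∀ n : ℕ, IsUnit (n ! : MvPolynomial σ L) := fun n => by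
    simpa using (hfac n).map (MvPolynomial.C (σ := σ))
  obtain ⟨h, h₁, h₂⟩ := exists_ringHom (fun n => (hfac' n).mem_nonZeroDivisors)
    ((MvPolynomial.C (σ := σ)).comp (algebraMap R L)) MvPolynomial.X
    (fun s n => (hfac' n).dvd)
  have hdp : ∀ (s : σ) (n : ℕ), h (dp R n (Finsupp.single s 1)) =
      MvPolynomial.monomial (Finsupp.single s n) ((hfac n).unit⁻¹ : Lˣ).val := fun s n => by
    apply (hfac' n).mul_left_cancel
    rw [← map_natCast h, ← map_mul, natFactorial_mul_dp_eq, map_pow, ← embed_def, h₂,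
      MvPolynomial.X_pow_eq_monomial, map_natCast, ← map_natCast (MvPolynomial.C (σ := σ) (R := L)),
      MvPolynomial.C_mul_monomial, IsUnit.mul_val_inv]
  have hprod : ∀ m : σ →₀ ℕ, ∃ w : Lˣ,
      h (m.prod fun i k => dp R k (Finsupp.single i (1 : R))) =
        MvPolynomial.monomial m (w : L) := fun m => by
    refine ⟨∏ i ∈ m.support, (hfac (m i)).unit⁻¹, ?_⟩
    have hm : ∑ i ∈ m.support, Finsupp.single i (m i) = m := m.sum_single
    rw [Finsupp.prod, map_prod, Finset.prod_congr rfl (fun i _ => hdp i (m i)),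
      ← MvPolynomial.monomial_sum_prod, Units.coe_prod, hm]
  choose w hw using hprod
  have hker : ∀ x, h x = 0 → x = 0 := fun x hx => by
    have hspan : Submodule.span R (Set.range fun s : σ => Finsupp.single s (1 : R)) = ⊤ := by
      have := (Finsupp.basisSingleOne (R := R) (ι := σ)).span_eq
      rwa [Finsupp.coe_basisSingleOne] at this
    have hx' : x ∈ Submodule.span R (Set.range fun m : σ →₀ ℕ =>
        m.prod fun i k => dp R k (Finsupp.single i (1 : R))) := by
      rw [submodule_span_prod_dp_eq_top hspan]
      trivial
    obtain ⟨c, rfl⟩ := Finsupp.mem_span_range_iff_exists_finsupp.mp hx'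
    suffices hc : c = 0 by simp [hc]
    ext m
    apply hinj
    apply (w m).isUnit.mul_left_injective
    have hm := congrArg (MvPolynomial.coeff m) hx
    have hterm : ∀ (i : σ →₀ ℕ) (a : R),
        h (a • i.prod fun i k => dp R k (Finsupp.single i (1 : R))) =
          MvPolynomial.monomial i (algebraMap R L a * w i) := fun i a => by
      rw [Algebra.smul_def, map_mul, h₁, hw, RingHom.comp_apply, MvPolynomial.C_mul_monomial]
    rw [Finsupp.sum, map_sum, Finset.sum_congr rfl (fun i _ => hterm i (c i)),
      MvPolynomial.coeff_sum, MvPolynomial.coeff_zero,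
      Finset.sum_congr rfl (fun i _ => MvPolynomial.coeff_monomial (m := m) i _)] at hm
    rw [Finset.sum_ite_eq'] at hm
    change algebraMap R L (c m) * w m = algebraMap R L 0 * w m
    rw [map_zero, zero_mul]
    split_ifs at hm with hmem
    · exact hm
    · rw [Finsupp.notMem_support_iff.mp hmem, map_zero, zero_mul]
  rw [mem_nonZeroDivisors_iff_right]
  intro x hx
  apply hker
  have hp' : IsUnit (p : MvPolynomial σ L) := by
    simpa using hpL.map (MvPolynomial.C (σ := σ))
  apply hp'.mul_left_injective
  simp only [zero_mul]
  rw [← map_natCast h, ← map_mul, hx, map_zero]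

end DividedPowerAlgebra

/-! ### Completion along a principal ideal. -/

namespace AdicCompletion

variable {S : Type u} [CommRing S] (a : S)

theorem exists_of_dvd_sub (x : AdicCompletion (Ideal.span {a}) S) :
    ∃ s : S, algebraMap S (AdicCompletion (Ideal.span {a}) S) a ∣ x - algebraMap S _ s := by
  obtain ⟨s, hs⟩ := Ideal.Quotient.mk_surjective (evalOneₐ (Ideal.span {a}) x)
  refine ⟨s, ?_⟩
  have hmem : x - algebraMap S _ s ∈ RingHom.ker (evalOneₐ (Ideal.span {a})) := by
    rw [RingHom.mem_ker, map_sub, AlgHom.commutes, ← hs]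
    simp
  have := ker_evalOneₐ_eq_map (I := Ideal.span {a}) (Submodule.fg_span_singleton a)
  rw [Ideal.map_span, Set.image_singleton] at this
  exact Ideal.mem_span_singleton.mp (this ▸ hmem)

theorem isAdicComplete_span :
    IsAdicComplete (Ideal.span {algebraMap S (AdicCompletion (Ideal.span {a}) S) a})
      (AdicCompletion (Ideal.span {a}) S) := by
  have h := AdicCompletion.isAdicComplete (M := S) (I := Ideal.span {a})
    (Submodule.fg_span_singleton a)
  have := (IsAdicComplete.map_algebraMap_iff (I := Ideal.span {a})
    (S := AdicCompletion (Ideal.span {a}) S) (M := AdicCompletion (Ideal.span {a}) S)).mpr h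
  rwa [Ideal.map_span, Set.image_singleton] at this

theorem factorPow_evalₐ (I : Ideal S) {m n : ℕ} (hmn : m ≤ n) (x : AdicCompletion I S) :
    Ideal.Quotient.factorPow I hmn (evalₐ I n x) = evalₐ I m x := by
  obtain ⟨r, rfl⟩ := mk_surjective I S x
  rw [evalₐ_mk, evalₐ_mk, ← Ideal.mk_eq_mk I hmn]
  rfl

theorem algebraMap_mem_nonZeroDivisors (ha : a ∈ nonZeroDivisors S) :
    algebraMap S (AdicCompletion (Ideal.span {a}) S) a ∈ nonZeroDivisors _ := by
  rw [mem_nonZeroDivisors_iff_right]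
  intro x hx
  have h0 : ∀ n, evalₐ (Ideal.span {a}) n 0 = 0 := fun n => _root_.map_zero _
  refine ext_evalₐ (I := Ideal.span {a}) fun n => ?_
  -- Work one level higher: cancelling `a` from `a s ∈ (a ^ (n + 1))` leaves only `s ∈ (a ^ n)`.
  obtain ⟨s, hs⟩ := Ideal.Quotient.mk_surjective (evalₐ (Ideal.span {a}) (n + 1) x)
  have h := congrArg (evalₐ (Ideal.span {a}) (n + 1)) hx
  rw [map_mul, AlgHom.commutes, ← hs, h0, Ideal.Quotient.algebraMap_eq, ← map_mul,
    Ideal.Quotient.eq_zero_iff_mem, Ideal.span_singleton_pow, Ideal.mem_span_singleton,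
    pow_succ] at h
  obtain ⟨t, ht⟩ := h
  have hst : s = a ^ n * t := (mul_cancel_right_mem_nonZeroDivisors ha).mp (by rw [ht]; ring)
  have htr : evalₐ (Ideal.span {a}) n x = Ideal.Quotient.mk _ s := by
    rw [← factorPow_evalₐ _ (Nat.le_succ n), ← hs]
    rfl
  rw [htr, h0, Ideal.Quotient.eq_zero_iff_mem, hst, Ideal.span_singleton_pow]
  exact Ideal.mul_mem_right _ _ (Ideal.mem_span_singleton_self _)

end AdicCompletion

/-- Writing `x = y + p z` with `h y = h' y` gives `h x - h' x = p (h z - h' z)`, so each iteration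
gains a factor `p`. This is density of a subring on which two maps agree. -/
theorem RingHom.dvd_of_forall_dvd {B C : Type u} [CommRing B] [CommRing C] {p : ℕ}
    (h h' : B →+* C) (hd : ∀ x, ∃ y, (p : B) ∣ x - y ∧ h y = h' y) (n : ℕ) (x : B) :
    (p : C) ^ n ∣ h x - h' x := by
  induction n generalizing x with
  | zero => simp
  | succ n ih =>
    obtain ⟨y, ⟨z, hz⟩, hy⟩ := hd x
    rw [eq_add_of_sub_eq hz, map_add, map_add, hy, add_sub_add_right_eq_sub, map_mul, map_mul,
      map_natCast, map_natCast, ← mul_sub, pow_succ']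
    exact mul_dvd_mul_left _ (ih z)

/-! ### The `p`-complete free pd-algebra and its universal property. -/

/-- `D` is the `p`-complete free pd-algebra on the family `x` over `R`, expressed by its
universal property with respect to `p`-torsion free `p`-complete rings. -/
structure IsPDPoly (p : ℕ) {R D : Type u} [CommRing R] [CommRing D] {σ : Type} (f : R →+* D)
    (x : σ → D) : Prop where
  crystalline : IsCrystalline p D
  dividedPowers : ∀ s, HasDividedPowers (x s)
  exists_lift : ∀ {B : Type u} [CommRing B], IsCrystalline p B → ∀ (g : R →+* B) (y : σ → B),
    (∀ s, HasDividedPowers (y s)) →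
      ∃ h : D →+* B, (∀ r, h (f r) = g r) ∧ ∀ s, h (x s) = y s
  hom_ext : ∀ {B : Type u} [CommRing B], IsCrystalline p B → ∀ h h' : D →+* B,
    (∀ r, h (f r) = h' (f r)) → (∀ s, h (x s) = h' (x s)) → h = h'

namespace PDPoly

variable {p : ℕ} {R : Type u} [CommRing R] {σ : Type}

theorem crystalline [Fact p.Prime] (hR : IsCrystalline p R) :
    IsCrystalline p (PDPoly p R σ) := by
  have h₁ := AdicCompletion.algebraMap_mem_nonZeroDivisors _
    (DividedPowerAlgebra.natCast_mem_nonZeroDivisors (σ := σ) hR)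
  have h₂ := AdicCompletion.isAdicComplete_span (p : DividedPowerAlgebra R (σ →₀ R))
  rw [map_natCast] at h₁ h₂
  exact ⟨h₁, h₂⟩

theorem exists_dvd_sub (x : PDPoly p R σ) :
    ∃ y : DividedPowerAlgebra R (σ →₀ R), (p : PDPoly p R σ) ∣ x - algebraMap _ _ y := by
  obtain ⟨y, hy⟩ := AdicCompletion.exists_of_dvd_sub _ x
  rw [map_natCast] at hy
  exact ⟨y, hy⟩

theorem algebraMap_eq (r : R) : algebraMap R (PDPoly p R σ) r =
    algebraMap (DividedPowerAlgebra R (σ →₀ R)) _ (algebraMap R _ r) := rfl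

theorem factorial_mul_dp (n : ℕ) (m : σ →₀ R) :
    (n ! : PDPoly p R σ) * algebraMap (DividedPowerAlgebra R (σ →₀ R)) _
      (DividedPowerAlgebra.dp R n m) =
    algebraMap (DividedPowerAlgebra R (σ →₀ R)) _ (DividedPowerAlgebra.embed R _ m) ^ n := by
  rw [← map_natCast (algebraMap (DividedPowerAlgebra R (σ →₀ R)) (PDPoly p R σ)), ← map_mul,
    DividedPowerAlgebra.natFactorial_mul_dp_eq, map_pow]
  rfl

theorem isPDPoly [Fact p.Prime] (hR : IsCrystalline p R) :
    IsPDPoly p (algebraMap R (PDPoly p R σ)) (PDPoly.X p R) where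
  crystalline := crystalline hR
  dividedPowers s n := ⟨_, (factorial_mul_dp n (Finsupp.single s 1)).symm⟩
  exists_lift {B} _ hB g y hy := by
    obtain ⟨h, h₁, h₂⟩ := DividedPowerAlgebra.exists_ringHom
      (fun n => hB.natCast_mem_nonZeroDivisors n.factorial_ne_zero) g y hy
    have := hB.complete
    have hle : ∀ n, Ideal.span {(p : DividedPowerAlgebra R (σ →₀ R))} ^ n ≤
        (Ideal.span {(p : B)} ^ n).comap h := fun n => by
      rw [Ideal.span_singleton_pow, Ideal.span_singleton_pow, Ideal.span_singleton_le_iff_mem,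
        Ideal.mem_comap, map_pow, map_natCast]
      exact Ideal.mem_span_singleton_self _
    let F : PDPoly p R σ →+* B := IsAdicComplete.liftRingHom (Ideal.span {(p : B)})
      (fun n => (Ideal.quotientMap _ h (hle n)).comp
        (AdicCompletion.evalₐ (Ideal.span {(p : DividedPowerAlgebra R (σ →₀ R))}) n :
          PDPoly p R σ →+* _))
      (fun {m n} hmn => by
        ext x
        simp only [RingHom.comp_apply, RingHom.coe_coe]
        rw [← AdicCompletion.factorPow_evalₐ _ hmn]
        obtain ⟨y, hy⟩ := Ideal.Quotient.mk_surjective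
          (AdicCompletion.evalₐ (Ideal.span {(p : DividedPowerAlgebra R (σ →₀ R))}) n x)
        rw [← hy]
        rfl)
    have hF : ∀ z, F (algebraMap _ _ z) = h z := fun z =>
      hB.eq_of_forall_pow_dvd_sub fun n => by
        rw [← Ideal.mem_span_singleton, ← Ideal.span_singleton_pow, ← Ideal.Quotient.eq,
          IsAdicComplete.mk_liftRingHom, RingHom.comp_apply, RingHom.coe_coe, AlgHom.commutes]
        rfl
    exact ⟨F, fun r => by rw [algebraMap_eq, hF, h₁], fun s => by rw [PDPoly.X, hF, h₂]⟩
  hom_ext {B} _ hB h h' h₁ h₂ := by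
    have key : h.comp (algebraMap (DividedPowerAlgebra R (σ →₀ R)) _) =
        h'.comp (algebraMap (DividedPowerAlgebra R (σ →₀ R)) _) :=
      DividedPowerAlgebra.ringHom_ext
        (fun n => hB.natCast_mem_nonZeroDivisors n.factorial_ne_zero) h₁ h₂
    refine RingHom.ext fun x => hB.eq_of_forall_pow_dvd_sub fun n =>
      RingHom.dvd_of_forall_dvd h h' (fun x => ?_) n x
    obtain ⟨y, hy⟩ := exists_dvd_sub x
    exact ⟨_, hy, RingHom.congr_fun key y⟩

/-- A ring endomorphism which lifts the Frobenius of the base and is divisible by `p` on the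
variables is a Frobenius lift. -/
theorem dvd_sub_pow [Fact p.Prime] (hR : IsCrystalline p R)
    (F : PDPoly p R σ →+* PDPoly p R σ)
    (h₁ : ∀ r : R, (p : PDPoly p R σ) ∣ F (algebraMap R _ r) - algebraMap R _ r ^ p)
    (h₂ : ∀ s, (p : PDPoly p R σ) ∣ F (PDPoly.X p R s)) (x : PDPoly p R σ) :
    (p : PDPoly p R σ) ∣ F x - x ^ p := by
  have hp := (Fact.out : p.Prime)
  have hD : IsCrystalline p (PDPoly p R σ) := crystalline hR
  have hadd : ∀ x y : PDPoly p R σ, (p : PDPoly p R σ) ∣ (x + y) ^ p - (x ^ p + y ^ p) :=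
    fun x y => ⟨_, by rw [DeltaStructure.add_pow_eq, add_sub_cancel_left]⟩
  have hlin : ∀ m : σ →₀ R, (p : PDPoly p R σ) ∣ F (algebraMap
      (DividedPowerAlgebra R (σ →₀ R)) _ (DividedPowerAlgebra.embed R _ m)) := fun m => by
    induction m using Finsupp.induction_linear with
    | zero => simp
    | add u v hu hv =>
      rw [map_add, map_add, map_add]
      exact dvd_add hu hv
    | single s r =>
      rw [← mul_one r, ← smul_eq_mul, ← Finsupp.smul_single, map_smul, Algebra.smul_def,
        map_mul, map_mul]
      exact (h₂ s).mul_left _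
  -- The value of `F` on the `n`-th divided power is `p ^ n v ^ n / n!`, and `n! p` divides `p ^ n`.
  have hdp : ∀ n ≠ 0, ∀ m : σ →₀ R, (p : PDPoly p R σ) ∣ F (algebraMap
      (DividedPowerAlgebra R (σ →₀ R)) _ (DividedPowerAlgebra.dp R n m)) := fun n hn m => by
    obtain ⟨v, hv⟩ := hlin m
    obtain ⟨c, hc⟩ := hD.factorial_mul_dvd_pow hn
    refine ⟨c * v ^ n, (mul_cancel_left_mem_nonZeroDivisors
      (hD.natCast_mem_nonZeroDivisors n.factorial_ne_zero)).mp ?_⟩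
    rw [← map_natCast F, ← map_mul, factorial_mul_dp, map_pow, hv, mul_pow, hc, map_natCast]
    push_cast
    ring
  -- The `p`-th power of `m^[n]` is `(p n)! / (n!)^p` times `m^[p n]`, and this coefficient is
  -- divisible by `p`.
  have hdp' : ∀ n ≠ 0, ∀ m : σ →₀ R, (p : PDPoly p R σ) ∣ (algebraMap
      (DividedPowerAlgebra R (σ →₀ R)) (PDPoly p R σ)
        (DividedPowerAlgebra.dp R n m)) ^ p := fun n hn m => by
    obtain ⟨c, hc⟩ := hD.factorial_pow_mul_dvd_factorial hn
    refine ⟨c * algebraMap (DividedPowerAlgebra R (σ →₀ R)) _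
      (DividedPowerAlgebra.dp R (p * n) m), (mul_cancel_left_mem_nonZeroDivisors
      (hD.natCast_mem_nonZeroDivisors (pow_ne_zero p n.factorial_ne_zero))).mp ?_⟩
    have h := factorial_mul_dp (p := p) (p * n) m
    rw [hc, mul_comm p n, pow_mul, ← factorial_mul_dp] at h
    push_cast at h ⊢
    rw [← mul_pow, ← h, mul_comm p n]
    ring
  have hbase : ∀ y : DividedPowerAlgebra R (σ →₀ R), (p : PDPoly p R σ) ∣
      F (algebraMap _ _ y) - algebraMap _ _ y ^ p := fun y => by
    induction y using DividedPowerAlgebra.induction_on with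
    | C a => exact h₁ a
    | add f g hf hg =>
      rw [map_add, map_add]
      convert (dvd_add hf hg).sub (hadd (algebraMap _ _ f) (algebraMap _ _ g)) using 1
      ring
    | dp f n m hf =>
      rw [map_mul, map_mul, mul_pow]
      rcases eq_or_ne n 0 with rfl | hn
      · simpa [DividedPowerAlgebra.dp_zero] using hf
      · exact dvd_sub ((hdp n hn m).mul_left _) ((hdp' n hn m).mul_left _)
  obtain ⟨y, z, hz⟩ := exists_dvd_sub x
  rw [eq_add_of_sub_eq hz, map_add, map_mul, map_natCast]
  have h := hadd (p * z) (algebraMap _ _ y)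
  rw [mul_pow] at h
  have h' : (p : PDPoly p R σ) ∣ p ^ p * z ^ p := (dvd_pow_self _ hp.ne_zero).mul_right _
  convert ((hbase y).sub h).add ((dvd_mul_right (p : PDPoly p R σ) (F z)).sub h') using 1
  ring

end PDPoly

namespace IsPDPoly

variable {p : ℕ} {R D E : Type u} [CommRing R] [CommRing D] [CommRing E] {σ τ : Type}
  {f : R →+* D} {x : σ → D}

theorem exists_ringEquiv (hD : IsPDPoly p f x) {g : R →+* E} {y : σ → E}
    (hE : IsPDPoly p g y) : ∃ e : D ≃+* E, (∀ r, e (f r) = g r) ∧ ∀ s, e (x s) = y s := by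
  obtain ⟨h, h₁, h₂⟩ := hD.exists_lift hE.crystalline g y hE.dividedPowers
  obtain ⟨k, k₁, k₂⟩ := hE.exists_lift hD.crystalline f x hD.dividedPowers
  refine ⟨RingEquiv.ofRingHom h k ?_ ?_, h₁, h₂⟩
  · exact hE.hom_ext hE.crystalline _ _ (fun r => by simp [k₁, h₁]) (fun s => by simp [k₂, h₂])
  · exact hD.hom_ext hD.crystalline _ _ (fun r => by simp [k₁, h₁]) (fun s => by simp [k₂, h₂])

theorem reindex (hD : IsPDPoly p f x) (e : τ ≃ σ) : IsPDPoly p f (x ∘ e) where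
  crystalline := hD.crystalline
  dividedPowers t := hD.dividedPowers _
  exists_lift hB g y hy := by
    obtain ⟨h, h₁, h₂⟩ := hD.exists_lift hB g (y ∘ e.symm) (fun s => hy _)
    exact ⟨h, h₁, fun t => by simp [h₂]⟩
  hom_ext hB h h' h₁ h₂ := hD.hom_ext hB h h' h₁ fun s => by simpa using h₂ (e.symm s)

/-- Applied to `R₁ → R₁₂ → R₁₂[Z]`, this exhibits the terms of the mixed nerve as pd-algebras over
`R₁` in `Y` and `Z`. -/
theorem trans (hD : IsPDPoly p f x) {g : D →+* E} {y : τ → E} (hE : IsPDPoly p g y) :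
    IsPDPoly p (g.comp f) (Sum.elim (g ∘ x) y) where
  crystalline := hE.crystalline
  dividedPowers := by
    rintro (s | t)
    · exact (hD.dividedPowers s).map g
    · exact hE.dividedPowers t
  exists_lift hB k z hz := by
    obtain ⟨h, h₁, h₂⟩ := hD.exists_lift hB k (z ∘ Sum.inl) (fun s => hz _)
    obtain ⟨l, l₁, l₂⟩ := hE.exists_lift hB h (z ∘ Sum.inr) (fun s => hz _)
    refine ⟨l, fun r => by simp [l₁, h₁], ?_⟩
    rintro (s | t)
    · simp [l₁, h₂]
    · simp [l₂]
  hom_ext hB h h' h₁ h₂ := by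
    refine hE.hom_ext hB h h' (fun r => ?_) (fun t => h₂ (Sum.inr t))
    exact RingHom.congr_fun (hD.hom_ext hB (h.comp g) (h'.comp g) h₁
      (fun s => h₂ (Sum.inl s))) r

theorem map_ringEquiv (hD : IsPDPoly p f x) (hE : IsCrystalline p E) (e : D ≃+* E) 
    {g : R →+* E} {y : σ → E} (hg : ∀ r, e (f r) = g r) (hy : ∀ s, e (x s) = y s) :
    IsPDPoly p g y where
  crystalline := hE
  dividedPowers s := hy s ▸ (hD.dividedPowers s).map (e : D →+* E)
  exists_lift hB k z hz := by
    obtain ⟨h, h₁, h₂⟩ := hD.exists_lift hB k z hz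
    exact ⟨h.comp (e.symm : E →+* D), fun r => by simp [← hg, h₁], fun s => by simp [← hy, h₂]⟩
  hom_ext hB h h' h₁ h₂ := by
    have := hD.hom_ext hB (h.comp (e : D →+* E)) (h'.comp (e : D →+* E))
      (fun r => by simp [hg, h₁]) (fun s => by simp [hy, h₂])
    ext z
    simpa using RingHom.congr_fun this (e.symm z)

end IsPDPoly

end DividedPowers

/-! ### Maps out of Laurent polynomial rings. -/

section Laurent

variable {S₀ C : Type u} [CommRing S₀] [CommRing C] {d : ℕ}

/-- Two ring homomorphisms out of a Laurent polynomial ring are equal if they agree on the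
coefficients and on the coordinates. -/
theorem AddMonoidAlgebra.ringHom_ext_of_coords
    {f g : AddMonoidAlgebra S₀ (Fin d → ℤ) →+* C}
    (h₁ : ∀ s, f (AddMonoidAlgebra.single 0 s) = g (AddMonoidAlgebra.single 0 s))
    (h₂ : ∀ k, f (AddMonoidAlgebra.single (Pi.single k 1) 1) =
      g (AddMonoidAlgebra.single (Pi.single k 1) 1)) : f = g := by
  have hmul : ∀ (F : AddMonoidAlgebra S₀ (Fin d → ℤ) →+* C) (x y : Fin d → ℤ),
      F (AddMonoidAlgebra.single (x + y) 1) =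
        F (AddMonoidAlgebra.single x 1) * F (AddMonoidAlgebra.single y 1) := fun F x y => by
    rw [← map_mul, AddMonoidAlgebra.single_mul_single, one_mul]
  have hone : ∀ F : AddMonoidAlgebra S₀ (Fin d → ℤ) →+* C,
      F (AddMonoidAlgebra.single 0 1) = 1 := fun F => map_one F
  -- The exponents at which `f` and `g` agree form a subgroup, by uniqueness of inverses, and the
  -- unit vectors generate.
  let H : AddSubgroup (Fin d → ℤ) :=
    { carrier := {x | f (AddMonoidAlgebra.single x 1) = g (AddMonoidAlgebra.single x 1)}
      zero_mem' := by
        change f _ = g _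
        rw [hone, hone]
      add_mem' := fun {x y} hx hy => by
        change f _ = g _
        rw [hmul, hmul, hx, hy]
      neg_mem' := fun {x} hx => by
        change f _ = g _
        have hx' : f (AddMonoidAlgebra.single x 1) = g (AddMonoidAlgebra.single x 1) := hx
        have e₁ := hmul f (-x) x
        have e₂ := hmul g x (-x)
        rw [neg_add_cancel, hone] at e₁
        rw [add_neg_cancel, hone] at e₂
        exact (left_inv_eq_right_inv e₁.symm (hx' ▸ e₂.symm)) }
  refine AddMonoidAlgebra.ringHom_ext h₁ fun x => ?_
  change x ∈ H
  rw [← Finset.univ_sum_single x]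
  refine sum_mem fun k _ => ?_
  have : (Pi.single k (x k) : Fin d → ℤ) = x k • Pi.single k 1 := by
    rw [← Pi.single_smul, smul_eq_mul, mul_one]
  rw [this]
  exact H.zsmul_mem (h₂ k) _

/-- A ring homomorphism out of a Laurent polynomial ring with prescribed values on the
coefficients and on the coordinates. -/
theorem AddMonoidAlgebra.exists_ringHom_of_coords (f : S₀ →+* C) (u : Fin d → Cˣ) :
    ∃ F : AddMonoidAlgebra S₀ (Fin d → ℤ) →+* C,
      (∀ s, F (algebraMap S₀ _ s) = f s) ∧
        ∀ k, F (AddMonoidAlgebra.single (Pi.single k 1) 1) = u k := by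
  let _ := f.toAlgebra
  let m : Multiplicative (Fin d → ℤ) →* Cˣ := MonoidHom.mk' (fun x => ∏ k, u k ^ x.toAdd k)
    fun x y => by simp [zpow_add, Finset.prod_mul_distrib]
  let F := AddMonoidAlgebra.lift S₀ C (Fin d → ℤ) ((Units.coeHom C).comp m)
  refine ⟨F.toRingHom, fun s => F.commutes s, fun k => ?_⟩
  change F _ = _
  rw [AddMonoidAlgebra.lift_single, one_smul, MonoidHom.comp_apply, Units.coeHom_apply]
  congr 1
  change ∏ l, u l ^ (Pi.single k 1 : Fin d → ℤ) l = u k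
  rw [Finset.prod_eq_single k]
  · simp
  · intro l _ hl
    simp [Pi.single_eq_of_ne hl]
  · simp

end Laurent

/-! ### Derivations along an étale chart. -/

section EtaleChart

variable {S₀ R₀ K : Type u} [CommRing S₀] [CommRing R₀] [CommRing K] [Algebra S₀ R₀] {d : ℕ}
  (chart : AddMonoidAlgebra S₀ (Fin d → ℤ) →ₐ[S₀] R₀)

theorem TrivSqZeroExt.isNilpotent_ker_fst :
    IsNilpotent (RingHom.ker (TrivSqZeroExt.fstHom K K K : TrivSqZeroExt K K →+* K)) := by
  refine ⟨2, ?_⟩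
  refine (_root_.pow_two
    (RingHom.ker (TrivSqZeroExt.fstHom K K K : TrivSqZeroExt K K →+* K))).trans ?_
  rw [Ideal.zero_eq_bot, eq_bot_iff, Ideal.mul_le]
  intro x hx y hy
  have hx' : x.fst = 0 := hx
  have hy' : y.fst = 0 := hy
  rw [Ideal.mem_bot]
  ext <;> simp [hx', hy']

include chart in
-- The two maps agree on Laurent polynomials and modulo a square-zero ideal, so formal
-- unramifiedness of the chart applies.
theorem RingHom.Etale.ext_trivSqZeroExt (hchart : chart.toRingHom.Etale)
    {h h' : R₀ →+* TrivSqZeroExt K K} (h₁ : ∀ r, (h r).fst = (h' r).fst)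
    (h₂ : ∀ s, h (algebraMap S₀ R₀ s) = h' (algebraMap S₀ R₀ s))
    (h₃ : ∀ k, h (chart (AddMonoidAlgebra.single (Pi.single k 1) 1)) =
      h' (chart (AddMonoidAlgebra.single (Pi.single k 1) 1))) : h = h' := by
  algebraize [chart.toRingHom]
  have hS : h.comp chart.toRingHom = h'.comp chart.toRingHom := by
    refine AddMonoidAlgebra.ringHom_ext_of_coords (fun s => ?_) h₃
    have hs : chart (AddMonoidAlgebra.single 0 s) = algebraMap S₀ R₀ s := chart.commutes s
    change h (chart _) = h' (chart _)
    rw [hs, h₂]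
  let _ : Algebra (AddMonoidAlgebra S₀ (Fin d → ℤ)) (TrivSqZeroExt K K) :=
    (h.comp chart.toRingHom).toAlgebra
  let g : R₀ →ₐ[AddMonoidAlgebra S₀ (Fin d → ℤ)] TrivSqZeroExt K K :=
    { h with commutes' := fun _ => rfl }
  let g' : R₀ →ₐ[AddMonoidAlgebra S₀ (Fin d → ℤ)] TrivSqZeroExt K K :=
    { h' with commutes' := fun x => (RingHom.congr_fun hS x).symm }
  have : g = g' := Algebra.FormallyUnramified.ext'
    (TrivSqZeroExt.fstHom K K K : TrivSqZeroExt K K →+* K)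
    TrivSqZeroExt.isNilpotent_ker_fst g g' h₁
  exact RingHom.ext fun x => AlgHom.congr_fun this x

include chart in
-- On Laurent polynomials send `T_k` to `g T_k + c_k ε`, a unit because its constant term is one;
-- formal smoothness of the chart extends this to `R₀`.
theorem RingHom.Etale.exists_trivSqZeroExt (hchart : chart.toRingHom.Etale)
    (g : R₀ →+* K) (c : Fin d → K) :
    ∃ h : R₀ →+* TrivSqZeroExt K K, (∀ r, (h r).fst = g r) ∧
      (∀ s, (h (algebraMap S₀ R₀ s)).snd = 0) ∧
      ∀ k, (h (chart (AddMonoidAlgebra.single (Pi.single k 1) 1))).snd = c k := by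
  algebraize [chart.toRingHom]
  have hunit : ∀ k, IsUnit (chart (AddMonoidAlgebra.single (Pi.single k 1) 1)) := fun k => by
    apply IsUnit.map
    refine IsUnit.of_mul_eq_one (AddMonoidAlgebra.single (-Pi.single k 1) 1) ?_
    rw [AddMonoidAlgebra.single_mul_single, add_neg_cancel, one_mul]
    rfl
  let t : Fin d → TrivSqZeroExt K K := fun k =>
    TrivSqZeroExt.inl (g (chart (AddMonoidAlgebra.single (Pi.single k 1) 1))) +
      TrivSqZeroExt.inr (c k)
  have ht : ∀ k, IsUnit (t k) := fun k => by
    rw [TrivSqZeroExt.isUnit_iff_isUnit_fst]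
    simpa [t] using (hunit k).map g
  obtain ⟨F, hF₁, hF₂⟩ := AddMonoidAlgebra.exists_ringHom_of_coords
    ((TrivSqZeroExt.inlHom K K).comp (g.comp (algebraMap S₀ R₀))) (fun k => (ht k).unit)
  have hF₂' : ∀ k, F (AddMonoidAlgebra.single (Pi.single k 1) 1) = t k := hF₂
  have hcomp : ((TrivSqZeroExt.fstHom K K K : TrivSqZeroExt K K →+* K)).comp F =
      g.comp chart.toRingHom := by
    refine AddMonoidAlgebra.ringHom_ext_of_coords (fun s => ?_) fun k => ?_
    · have hs : chart (AddMonoidAlgebra.single 0 s) = algebraMap S₀ R₀ s := chart.commutes s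
      change (F (algebraMap S₀ _ s)).fst = g (chart _)
      rw [hF₁, hs]
      rfl
    · change (F _).fst = g (chart _)
      rw [hF₂']
      simp [t]
  let _ : Algebra (AddMonoidAlgebra S₀ (Fin d → ℤ)) (TrivSqZeroExt K K) := F.toAlgebra
  let _ : Algebra (AddMonoidAlgebra S₀ (Fin d → ℤ)) K := (g.comp chart.toRingHom).toAlgebra
  let π : TrivSqZeroExt K K →ₐ[AddMonoidAlgebra S₀ (Fin d → ℤ)] K :=
    { (TrivSqZeroExt.fstHom K K K : TrivSqZeroExt K K →+* K) with
      commutes' := fun x => RingHom.congr_fun hcomp x }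
  let g' : R₀ →ₐ[AddMonoidAlgebra S₀ (Fin d → ℤ)] K := { g with commutes' := fun _ => rfl }
  have hπ : Function.Surjective π := fun x => ⟨TrivSqZeroExt.inl x, TrivSqZeroExt.fst_inl K x⟩
  let G := Algebra.FormallySmooth.liftOfSurjective g' π hπ TrivSqZeroExt.isNilpotent_ker_fst
  have hG : ∀ x, G (chart x) = F x := fun x => G.commutes x
  refine ⟨G.toRingHom, fun r => Algebra.FormallySmooth.liftOfSurjective_apply g' π hπ
    TrivSqZeroExt.isNilpotent_ker_fst r, fun s => ?_, fun k => ?_⟩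
  · change (G _).snd = 0
    rw [← chart.commutes, hG, hF₁]
    simp
  · change (G (chart _)).snd = _
    rw [hG, hF₂']
    simp [t]

end EtaleChart

/-! ### Smooth lifting, and coordinates for derivations on `R`. -/

section Lifting

variable {p : ℕ} {A R : Type u} [CommRing A] [CommRing R] [Algebra A R]

/-- Because `p ^ n` vanishes in `C` and `C'`, the problem lives over `A / p ^ n`, where the base
change of `R` is formally smooth. -/
theorem IsPCompletelySmooth.exists_lift (hR : IsPCompletelySmooth p A R) {C C' : Type u}
    [CommRing C] [CommRing C'] [Algebra A C] [Algebra A C'] (π : C →ₐ[A] C')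
    (hπ : Function.Surjective π) (hker : IsNilpotent (RingHom.ker (π : C →+* C')))
    {n : ℕ} (hn : (p : C) ^ n = 0) (f : R →ₐ[A] C') :
    ∃ g : R →ₐ[A] C, ∀ r, π (g r) = f r := by
  have hn' : (p : C') ^ n = 0 := by
    rw [← map_natCast π, ← map_pow, hn, map_zero]
  have hspan : ∀ {E : Type u} [CommRing E] [Algebra A E], (p : E) ^ n = 0 →
      ∀ a ∈ Ideal.span {(p : A) ^ n}, algebraMap A E a = 0 := fun hE a ha => by
    obtain ⟨b, rfl⟩ := Ideal.mem_span_singleton'.mp ha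
    rw [map_mul, map_pow, map_natCast, hE, mul_zero]
  let _ : Algebra (A ⧸ Ideal.span {(p : A) ^ n}) C :=
    (Ideal.Quotient.lift _ (algebraMap A C) (hspan hn)).toAlgebra
  let _ : Algebra (A ⧸ Ideal.span {(p : A) ^ n}) C' :=
    (Ideal.Quotient.lift _ (algebraMap A C') (hspan hn')).toAlgebra
  have : IsScalarTower A (A ⧸ Ideal.span {(p : A) ^ n}) C := .of_algebraMap_eq fun _ => rfl
  have : IsScalarTower A (A ⧸ Ideal.span {(p : A) ^ n}) C' := .of_algebraMap_eq fun _ => rfl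
  let π' : C →ₐ[A ⧸ Ideal.span {(p : A) ^ n}] C' :=
    { (π : C →+* C') with
      commutes' := fun x => by
        obtain ⟨a, rfl⟩ := Ideal.Quotient.mk_surjective x
        exact π.commutes a }
  let F : (A ⧸ Ideal.span {(p : A) ^ n}) ⊗[A] R →ₐ[A ⧸ Ideal.span {(p : A) ^ n}] C' :=
    Algebra.TensorProduct.lift (Algebra.ofId _ C') f (fun _ _ => Commute.all _ _)
  have := hR.smooth n
  let G := Algebra.FormallySmooth.liftOfSurjective F π' hπ hker
  refine ⟨(G.restrictScalars A).comp Algebra.TensorProduct.includeRight, fun r => ?_⟩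
  refine (Algebra.FormallySmooth.liftOfSurjective_apply F π' hπ hker (1 ⊗ₜ r)).trans ?_
  simp [F]

/-- The elements `T` of the `A`-algebra `R` are étale coordinates: maps from `R` to `p`-torsion
free `p`-complete rings are determined by, and can be constructed from, their reduction
modulo `p` and their values on `T`. -/
structure IsEtaleCoordinates (p : ℕ) (A : Type u) {R : Type u} [CommRing A] [CommRing R]
    [Algebra A R] {d : ℕ} (T : Fin d → R) : Prop where
  hom_ext : ∀ {B : Type u} [CommRing B], IsCrystalline p B → ∀ f f' : R →+* B,
    (∀ a, f (algebraMap A R a) = f' (algebraMap A R a)) → (∀ r, (p : B) ∣ f r - f' r) →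
      (∀ k, f (T k) = f' (T k)) → f = f'
  exists_lift : ∀ {B : Type u} [CommRing B] [Algebra A B], IsCrystalline p B →
    ∀ (g : R →ₐ[A] B ⧸ Ideal.span {(p : B)}) (t : Fin d → B),
      (∀ k, Ideal.Quotient.mk _ (t k) = g (T k)) →
        ∃ f : R →ₐ[A] B, (∀ r, Ideal.Quotient.mk _ (f r) = g r) ∧ ∀ k, f (T k) = t k

/-- Derivations on `R` with values in a ring of characteristic `p` are determined by, and can be
constructed from, their values on `T`. Derivations are expressed as ring homomorphisms to
trivial square-zero extensions. -/
structure HasDerivationCoordinates (p : ℕ) (A : Type u) {R : Type u} [CommRing A] [CommRing R]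
    [Algebra A R] {d : ℕ} (T : Fin d → R) : Prop where
  hom_ext : ∀ {K : Type u} [CommRing K], (p : K) = 0 → ∀ h h' : R →+* TrivSqZeroExt K K,
    (∀ r, (h r).fst = (h' r).fst) → (∀ a, h (algebraMap A R a) = h' (algebraMap A R a)) →
      (∀ k, h (T k) = h' (T k)) → h = h'
  exists_hom : ∀ {K : Type u} [CommRing K], (p : K) = 0 → ∀ (g : R →+* K) (c : Fin d → K),
    ∃ h : R →+* TrivSqZeroExt K K, (∀ r, (h r).fst = g r) ∧
      (∀ a, (h (algebraMap A R a)).snd = 0) ∧ ∀ k, (h (T k)).snd = c k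

/-- In characteristic `p` every map out of `R` factors through `R / p ≅ R₀`, where the étale chart
is available. -/
theorem hasDerivationCoordinates_of_etale {R₀ : Type u} [CommRing R₀] [Algebra A R₀]
    [Algebra (A ⧸ Ideal.span {(p : A)}) R₀] [IsScalarTower A (A ⧸ Ideal.span {(p : A)}) R₀]
    {d : ℕ} (chart : AddMonoidAlgebra (A ⧸ Ideal.span {(p : A)}) (Fin d → ℤ)
      →ₐ[A ⧸ Ideal.span {(p : A)}] R₀)
    (hchart : chart.toRingHom.Etale) (red : (R ⧸ Ideal.span {(p : R)}) ≃ₐ[A] R₀)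
    (T : Fin d → R)
    (hT : ∀ k, red (Ideal.Quotient.mk _ (T k)) =
      chart (AddMonoidAlgebra.single (Pi.single k 1) 1)) :
    HasDerivationCoordinates p A T := by
  let ρ : R →+* R₀ := (red : R ⧸ Ideal.span {(p : R)} →+* R₀).comp (Ideal.Quotient.mk _)
  have hρA : ∀ a : A, ρ (algebraMap A R a) =
      algebraMap (A ⧸ Ideal.span {(p : A)}) R₀ (Ideal.Quotient.mk _ a) := fun a => by
    change red (algebraMap A _ a) = _
    rw [red.commutes, IsScalarTower.algebraMap_apply A (A ⧸ Ideal.span {(p : A)}) R₀]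
    rfl
  have hρT : ∀ k, ρ (T k) = chart (AddMonoidAlgebra.single (Pi.single k 1) 1) := hT
  have hρs : Function.Surjective ρ := red.surjective.comp Ideal.Quotient.mk_surjective
  have hfac : ∀ {C : Type u} [CommRing C], (p : C) = 0 → ∀ h : R →+* C,
      ∃ h₀ : R₀ →+* C, ∀ r, h₀ (ρ r) = h r := fun hC h => by
    refine ⟨(Ideal.Quotient.lift (Ideal.span {(p : R)}) h fun a ha => ?_).comp
      (red.symm : R₀ →+* R ⧸ Ideal.span {(p : R)}), fun r => ?_⟩
    · obtain ⟨b, rfl⟩ := Ideal.mem_span_singleton'.mp ha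
      rw [map_mul, map_natCast, hC, mul_zero]
    · rw [RingHom.comp_apply]
      simp [ρ]
  have hpC : ∀ {K : Type u} [CommRing K], (p : K) = 0 → (p : TrivSqZeroExt K K) = 0 :=
    fun {K} _ hK => by
      rw [← map_natCast (TrivSqZeroExt.inlHom K K), hK, map_zero]
  constructor
  · intro K _ hK h h' h₁ h₂ h₃
    obtain ⟨h₀, hh₀⟩ := hfac (hpC hK) h
    obtain ⟨h₀', hh₀'⟩ := hfac (hpC hK) h'
    have : h₀ = h₀' := by
      apply hchart.ext_trivSqZeroExt
      · intro r
        obtain ⟨r, rfl⟩ := hρs r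
        rw [hh₀, hh₀', h₁]
      · intro s
        obtain ⟨a, rfl⟩ := Ideal.Quotient.mk_surjective s
        rw [← hρA, hh₀, hh₀', h₂]
      · intro k
        rw [← hρT, hh₀, hh₀', h₃]
    ext1 r
    rw [← hh₀, ← hh₀', this]
  · intro K _ hK g c
    obtain ⟨g₀, hg₀⟩ := hfac hK g
    obtain ⟨h, h₁, h₂, h₃⟩ := hchart.exists_trivSqZeroExt chart g₀ c
    refine ⟨h.comp ρ, fun r => ?_, fun a => ?_, fun k => ?_⟩
    · rw [RingHom.comp_apply, h₁, hg₀]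
    · rw [RingHom.comp_apply, hρA, h₂]
    · rw [RingHom.comp_apply, hρT, h₃]

end Lifting

/-! ### From derivations modulo `p` to `p`-adic étale coordinates. -/

section Lifting

variable {p : ℕ} {A R : Type u} [CommRing A] [CommRing R] [Algebra A R] {d : ℕ} {T : Fin d → R}

theorem Ideal.Quotient.natCast_span_self (p : ℕ) (B : Type u) [CommRing B] :
    (p : B ⧸ Ideal.span {(p : B)}) = 0 := by
  rw [← map_natCast (Ideal.Quotient.mk (Ideal.span {(p : B)})), Ideal.Quotient.eq_zero_iff_mem]
  exact Ideal.mem_span_singleton_self _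

theorem Ideal.Quotient.natCast_span_pow (p : ℕ) (B : Type u) [CommRing B] (n : ℕ) :
    (p : B ⧸ Ideal.span {(p : B)} ^ n) ^ n = 0 := by
  rw [← map_natCast (Ideal.Quotient.mk (Ideal.span {(p : B)} ^ n)), ← map_pow,
    Ideal.Quotient.eq_zero_iff_mem, Ideal.span_singleton_pow]
  exact Ideal.mem_span_singleton_self _

/-- If `f ≡ f'` modulo `p ^ (n + 1)`, then `(f - f') / p ^ (n + 1)` reduces modulo `p` to a
derivation that kills `A` and `T`, hence to zero. The congruence improves indefinitely and `B` is
separated. -/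
theorem HasDerivationCoordinates.ringHom_ext (hT : HasDerivationCoordinates p A T) {B : Type u}
    [CommRing B] (hB : IsCrystalline p B) (f f' : R →+* B)
    (hA : ∀ a, f (algebraMap A R a) = f' (algebraMap A R a))
    (hmod : ∀ r, (p : B) ∣ f r - f' r) (hTf : ∀ k, f (T k) = f' (T k)) : f = f' := by
  suffices h : ∀ n r, (p : B) ^ (n + 1) ∣ f r - f' r from
    RingHom.ext fun r => hB.eq_of_forall_pow_dvd_sub fun n =>
      (pow_dvd_pow _ n.le_succ).trans (h n r)
  intro n
  induction n with
  | zero => simpa using hmod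
  | succ n ih =>
    choose E hE using ih
    have cancel : ∀ {a b : B}, (p : B) ^ (n + 1) * a = (p : B) ^ (n + 1) * b → a = b :=
      fun h => (mul_cancel_left_mem_nonZeroDivisors (hB.pow_mem_nonZeroDivisors _)).mp h
    let q := Ideal.Quotient.mk (Ideal.span {(p : B)})
    have hq : ∀ r, q (f r) = q (f' r) := fun r => by
      rw [Ideal.Quotient.eq, Ideal.mem_span_singleton]
      exact hmod r
    have hE0 : ∀ r, f r = f' r → E r = 0 := fun r hr => cancel (by
      rw [← hE, hr, sub_self, mul_zero])
    let h : R →+* TrivSqZeroExt (B ⧸ Ideal.span {(p : B)}) (B ⧸ Ideal.span {(p : B)}) :=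
      { toFun := fun r => TrivSqZeroExt.inl (q (f r)) + TrivSqZeroExt.inr (q (E r))
        map_zero' := by simp [hE0 0]
        map_one' := by simp [hE0 1]
        map_add' := fun r s => by
          have : E (r + s) = E r + E s := cancel (by
            rw [← hE, mul_add, ← hE, ← hE, map_add, map_add]
            ring)
          ext <;> simp [this]
        map_mul' := fun r s => by
          have : E (r * s) = f r * E s + f' s * E r := cancel (by
            rw [← hE, map_mul, map_mul]
            linear_combination f r * hE s + f' s * hE r)
          ext <;> simp [this, hq, mul_comm] }
    have key := hT.hom_ext (Ideal.Quotient.natCast_span_self p B) h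
      ((TrivSqZeroExt.inlHom _ _).comp (q.comp f)) (fun r => by simp [h])
      (fun a => by simp [h, hE0 _ (hA a)]) (fun k => by simp [h, hE0 _ (hTf k)])
    intro r
    have hr : q (E r) = 0 := by
      simpa [h] using congrArg TrivSqZeroExt.snd (RingHom.congr_fun key r)
    rw [hE, pow_succ _ (n + 1)]
    exact mul_dvd_mul_left _ (Ideal.mem_span_singleton.mp (Ideal.Quotient.eq_zero_iff_mem.mp hr))

/-- Smoothness gives some lift `F` modulo `p ^ (n + 2)`, wrong on `T_k` by `p ^ (n + 1) c_k`. Adding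
`p ^ (n + 1) D`, for a derivation `D` to `B / p` with `D T_k = c_k`, corrects it. -/
theorem HasDerivationCoordinates.exists_lift_succ (hT : HasDerivationCoordinates p A T)
    (hR : IsPCompletelySmooth p A R) {B : Type u} [CommRing B] [Algebra A B]
    (g : R →ₐ[A] B ⧸ Ideal.span {(p : B)}) (t : Fin d → B) (n : ℕ)
    (f : R →ₐ[A] B ⧸ Ideal.span {(p : B)} ^ (n + 1))
    (hfg : ∀ r b, f r = Ideal.Quotient.mk _ b → g r = Ideal.Quotient.mk _ b)
    (hft : ∀ k, f (T k) = Ideal.Quotient.mk _ (t k)) :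
    ∃ f' : R →ₐ[A] B ⧸ Ideal.span {(p : B)} ^ (n + 2),
      (∀ r b, f' r = Ideal.Quotient.mk _ b → f r = Ideal.Quotient.mk _ b) ∧
        ∀ k, f' (T k) = Ideal.Quotient.mk _ (t k) := by
  let π : B ⧸ Ideal.span {(p : B)} ^ (n + 2) →ₐ[A] B ⧸ Ideal.span {(p : B)} ^ (n + 1) :=
    Ideal.Quotient.factorₐ A (Ideal.pow_le_pow_right (n + 1).le_succ)
  have hπ : ∀ b : B, π (Ideal.Quotient.mk _ b) = Ideal.Quotient.mk _ b := fun _ => rfl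
  have hπs : Function.Surjective π := fun x => by
    obtain ⟨b, rfl⟩ := Ideal.Quotient.mk_surjective x
    exact ⟨_, hπ b⟩
  have hker : ∀ x, π x = 0 → ∃ b : B, x = Ideal.Quotient.mk _ ((p : B) ^ (n + 1) * b) :=
    fun x hx => by
      obtain ⟨b, rfl⟩ := Ideal.Quotient.mk_surjective x
      rw [hπ, Ideal.Quotient.eq_zero_iff_mem, Ideal.span_singleton_pow,
        Ideal.mem_span_singleton] at hx
      obtain ⟨c, rfl⟩ := hx
      exact ⟨c, rfl⟩
  have hnil : IsNilpotent (RingHom.ker (π : B ⧸ Ideal.span {(p : B)} ^ (n + 2) →+*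
      B ⧸ Ideal.span {(p : B)} ^ (n + 1))) := by
    refine ⟨2, (_root_.pow_two (RingHom.ker (π : B ⧸ Ideal.span {(p : B)} ^ (n + 2) →+*
      B ⧸ Ideal.span {(p : B)} ^ (n + 1)))).trans ?_⟩
    rw [Ideal.zero_eq_bot, eq_bot_iff, Ideal.mul_le]
    intro x hx y hy
    obtain ⟨b, rfl⟩ := hker x hx
    obtain ⟨c, rfl⟩ := hker y hy
    rw [Ideal.mem_bot, ← map_mul, Ideal.Quotient.eq_zero_iff_mem, Ideal.span_singleton_pow,
      Ideal.mem_span_singleton]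
    exact ⟨(p : B) ^ n * (b * c), by ring⟩
  obtain ⟨F, hF⟩ := hR.exists_lift π hπs hnil (Ideal.Quotient.natCast_span_pow p B (n + 2)) f
  have hFt : ∀ k, ∃ b : B, Ideal.Quotient.mk _ (t k) - F (T k) =
      Ideal.Quotient.mk _ ((p : B) ^ (n + 1) * b) := fun k =>
    hker _ (by rw [map_sub, hF, hπ, hft, sub_self])
  choose c hc using hFt
  obtain ⟨D, hD₁, hD₂, hD₃⟩ := hT.exists_hom (Ideal.Quotient.natCast_span_self p B)
    (g : R →+* B ⧸ Ideal.span {(p : B)}) (fun k => Ideal.Quotient.mk _ (c k))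
  -- Multiplication by `p ^ (n + 1)`, well defined on classes modulo `p`. Its image squares to zero,
  -- so `F + m ∘ D` is multiplicative.
  let m : B ⧸ Ideal.span {(p : B)} →+ B ⧸ Ideal.span {(p : B)} ^ (n + 2) :=
    QuotientAddGroup.lift _ ((Ideal.Quotient.mk (Ideal.span {(p : B)} ^ (n + 2))).toAddMonoidHom.comp
      (AddMonoidHom.mulLeft ((p : B) ^ (n + 1)))) (fun x hx => by
        obtain ⟨y, rfl⟩ := Ideal.mem_span_singleton'.mp hx
        change Ideal.Quotient.mk _ _ = _
        rw [Ideal.Quotient.eq_zero_iff_mem, Ideal.span_singleton_pow, Ideal.mem_span_singleton]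
        exact ⟨y, by simp only [AddMonoidHom.coe_mulLeft]; ring⟩)
  have hm : ∀ b : B, m (Ideal.Quotient.mk _ b) =
      Ideal.Quotient.mk _ ((p : B) ^ (n + 1) * b) := fun _ => rfl
  have hmm : ∀ κ κ', m κ * m κ' = 0 := fun κ κ' => by
    obtain ⟨b, rfl⟩ := Ideal.Quotient.mk_surjective κ
    obtain ⟨c, rfl⟩ := Ideal.Quotient.mk_surjective κ'
    rw [hm, hm, ← map_mul, Ideal.Quotient.eq_zero_iff_mem, Ideal.span_singleton_pow,
      Ideal.mem_span_singleton]
    exact ⟨(p : B) ^ n * (b * c), by ring⟩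
  have hFm : ∀ r κ, F r * m κ = m (g r * κ) := fun r κ => by
    obtain ⟨c, rfl⟩ := Ideal.Quotient.mk_surjective κ
    obtain ⟨b, hb⟩ := Ideal.Quotient.mk_surjective (F r)
    rw [hfg r b (by rw [← hF, ← hb, hπ]), ← map_mul, hm, hm, ← hb, ← map_mul]
    congr 1
    ring
  have hπm : ∀ κ, π (m κ) = 0 := fun κ => by
    obtain ⟨c, rfl⟩ := Ideal.Quotient.mk_surjective κ
    rw [hm, hπ, Ideal.Quotient.eq_zero_iff_mem, Ideal.span_singleton_pow,
      Ideal.mem_span_singleton]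
    exact dvd_mul_right _ _
  let f' : R →ₐ[A] B ⧸ Ideal.span {(p : B)} ^ (n + 2) :=
    { toFun := fun r => F r + m (D r).snd
      map_zero' := by simp
      map_one' := by simp
      map_add' := fun r s => by
        simp only [map_add, TrivSqZeroExt.snd_add]
        ring
      map_mul' := fun r s => by
        simp only [map_mul, TrivSqZeroExt.snd_mul, hD₁, map_add, smul_eq_mul,
          MulOpposite.smul_eq_mul_unop, MulOpposite.unop_op, RingHom.coe_coe]
        rw [mul_comm (D r).snd, ← hFm, ← hFm]
        linear_combination -hmm (D r).snd (D s).snd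
      commutes' := fun a => by rw [hD₂, map_zero, add_zero, F.commutes] }
  have hf' : ∀ r, f' r = F r + m (D r).snd := fun _ => rfl
  refine ⟨f', fun r b hb => ?_, fun k => ?_⟩
  · rw [← hF, ← hπ, ← hb, hf', map_add, hπm, add_zero]
  · rw [hf', hD₃, hm, ← hc]
    ring

theorem HasDerivationCoordinates.isEtaleCoordinates (hT : HasDerivationCoordinates p A T)
    (hR : IsPCompletelySmooth p A R) : IsEtaleCoordinates p A T where
  hom_ext hB f f' := hT.ringHom_ext hB f f'
  exists_lift {B} _ _ hB g t ht := by
    let P : ∀ n, (R →ₐ[A] B ⧸ Ideal.span {(p : B)} ^ (n + 1)) → Prop := fun n f =>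
      (∀ r b, f r = Ideal.Quotient.mk _ b → g r = Ideal.Quotient.mk _ b) ∧
        ∀ k, f (T k) = Ideal.Quotient.mk _ (t k)
    have hstep : ∀ n (f : {f // P n f}), ∃ f' : {f // P (n + 1) f},
        ∀ r b, f'.1 r = Ideal.Quotient.mk _ b → f.1 r = Ideal.Quotient.mk _ b := fun n f => by
      obtain ⟨f', h₁, h₂⟩ := hT.exists_lift_succ hR g t n f.1 f.2.1 f.2.2
      exact ⟨⟨f', fun r b hb => f.2.1 r b (h₁ r b hb), h₂⟩, h₁⟩
    choose next hnext using hstep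
    -- Stage `n` lives modulo `p ^ (n + 1)`, so the tower starts from `g` itself; its limit exists
    -- by completeness of `B`.
    let ε : (B ⧸ Ideal.span {(p : B)}) ≃ₐ[A] B ⧸ Ideal.span {(p : B)} ^ (0 + 1) :=
      Ideal.quotientEquivAlgOfEq A (by rw [zero_add, pow_one])
    have hε : ∀ b : B, ε (Ideal.Quotient.mk _ b) = Ideal.Quotient.mk _ b := fun _ => rfl
    let F : ∀ n, {f // P n f} := fun n => Nat.rec
      ⟨ε.toAlgHom.comp g, fun r b hb => ε.injective hb, fun k =>
        (congrArg ε (ht k).symm).trans (hε _)⟩ next n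
    have hF : ∀ n r b, (F (n + 1)).1 r = Ideal.Quotient.mk _ b →
        (F n).1 r = Ideal.Quotient.mk _ b := fun n => hnext n (F n)
    have := hB.complete
    have hmono : StrictMono fun n : ℕ => n + 1 := fun _ _ h => Nat.succ_lt_succ h
    let L : R →+* B := IsAdicComplete.StrictMono.liftRingHom (Ideal.span {(p : B)}) hmono
      (fun n => ((F n).1 : R →+* B ⧸ Ideal.span {(p : B)} ^ (n + 1))) (fun {n} => by
        ext r
        obtain ⟨b, hb⟩ := Ideal.Quotient.mk_surjective ((F (n + 1)).1 r)
        simp only [RingHom.comp_apply, RingHom.coe_coe]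
        rw [hF n r b hb.symm, ← hb]
        rfl)
    have hL : ∀ n r, Ideal.Quotient.mk (Ideal.span {(p : B)} ^ (n + 1)) (L r) = (F n).1 r :=
      fun n r => IsAdicComplete.StrictMono.mk_liftRingHom _ hmono _ _ r
    have heq : ∀ r b, (∀ n, (F n).1 r = Ideal.Quotient.mk _ b) → L r = b := fun r b h =>
      hB.eq_of_forall_pow_dvd_sub fun n => by
        refine (pow_dvd_pow _ n.le_succ).trans ?_
        rw [← Ideal.mem_span_singleton, ← Ideal.span_singleton_pow, ← Ideal.Quotient.eq, hL, h]
    refine ⟨{ L with commutes' := fun a => heq _ _ fun n => (F n).1.commutes a }, fun r => ?_,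
      fun k => heq _ _ fun n => (F n).2.2 k⟩
    exact ((F 0).2.1 r _ (hL 0 r).symm).symm

end Lifting

/-! ### Comparison of two Frobenius lifts modulo `p²`. -/

namespace DeltaStructure

variable {p : ℕ} [Fact p.Prime] {A R B : Type u} [CommRing A] [CommRing R] [CommRing B]

/-- Elements congruent modulo `p` have `p`-th powers congruent modulo `p²`, and the terms `p δ`
differ by `p` times a multiple of `p`. The congruence of the `δ`-structures enters the coproducts
only through this estimate. -/
theorem sq_dvd_map_frobenius_sub {δ δ' : DeltaStructure p R} (f f' : R →+* B)
    (hδ : ∀ x, (p : R) ∣ δ.δ x - δ'.δ x) (hf : ∀ x, (p : B) ∣ f x - f' x) (x : R) :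
    (p : B) ^ 2 ∣ f (δ.frobenius x) - f' (δ'.frobenius x) := by
  have h₁ : (p : B) ^ 2 ∣ f x ^ p - f' x ^ p := by
    simpa using dvd_sub_pow_of_dvd_sub (R := B) (p := p) (hf x) 1
  have h₂ : (p : B) ∣ f (δ.δ x) - f' (δ'.δ x) := by
    have h := _root_.map_dvd f (hδ x)
    rw [map_natCast, map_sub] at h
    simpa only [sub_add_sub_cancel] using h.add (hf (δ'.δ x))
  have h₃ := h₁.add ((pow_two (p : B)).symm ▸ mul_dvd_mul_left (p : B) h₂)
  convert h₃ using 1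
  simp only [frobenius_apply, _root_.map_add, map_pow, _root_.map_mul, map_natCast]
  ring

theorem IsCompatible.frobenius_algebraMap [Algebra A B] {δB : DeltaStructure p B}
    {δA : DeltaStructure p A} (h : δB.IsCompatible δA) (a : A) :
    δB.frobenius (algebraMap A B a) = algebraMap A B (δA.frobenius a) := by
  rw [frobenius_apply, frobenius_apply, h a]
  simp

end DeltaStructure

/-! ### Morphisms of prisms and the construction of coproducts. -/

namespace PrismOver

variable {p : ℕ} {A : Type u} [CommRing A] {δA : DeltaStructure p A}
  {R₀ : Type u} [CommRing R₀] [Algebra A R₀]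

theorem Hom.ringHom_algebraMap {B C : PrismOver p δA R₀} (f : B ⟶ C) (a : A) :
    Hom.ringHom f (algebraMap A _ a) = algebraMap A _ a :=
  (Hom.toAlgHom f).commutes a

theorem Hom.ringHom_comp {B C D : PrismOver p δA R₀} (f : B ⟶ C) (g : C ⟶ D) (x : B.carrier) :
    Hom.ringHom (f ≫ g) x = Hom.ringHom g (Hom.ringHom f x) := rfl

theorem Hom.ringHom_id (B : PrismOver p δA R₀) (x : B.carrier) :
    Hom.ringHom (𝟙 B) x = x := rfl

theorem Hom.ext_ringHom {B C : PrismOver p δA R₀} {f g : B ⟶ C}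
    (h : ∀ x, Hom.ringHom f x = Hom.ringHom g x) : f = g :=
  Hom.ext (AlgHom.ext h)

/-- An isomorphism of prisms induces an isomorphism of rings. -/
def ringEquivOfIso {B C : PrismOver p δA R₀} (e : B ≅ C) : B.carrier ≃+* C.carrier :=
  RingEquiv.ofRingHom (Hom.ringHom e.hom) (Hom.ringHom e.inv)
    (by ext x; simp [← Hom.ringHom_comp, Hom.ringHom_id])
    (by ext x; simp [← Hom.ringHom_comp, Hom.ringHom_id])

theorem Hom.frobenius [Fact p.Prime] {B C : PrismOver p δA R₀} (f : B ⟶ C) (x : B.carrier) :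
    Hom.ringHom f (B.delta.frobenius x) = C.delta.frobenius (Hom.ringHom f x) :=
  (DeltaStructure.map_delta_iff C.crystalline B.delta C.delta (Hom.ringHom f) x).mp
    (Hom.map_delta f x)

section OfLift

variable {R : Type u} [CommRing R] [Algebra A R] {hA : IsCrystalline p A}
  {hR : IsPCompletelySmooth p A R} {red : (R ⧸ Ideal.span {(p : R)}) ≃ₐ[A] R₀}
  {δ δ' : DeltaStructure p R} {h : δ.IsCompatible δA} {h' : δ'.IsCompatible δA}

theorem mk_ringHom_ofLift {B : PrismOver p δA R₀} (f : ofLift hA hR red δ h ⟶ B) (r : R) :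
    Ideal.Quotient.mk (Ideal.span {(p : B.carrier)}) (Hom.ringHom f r) =
      B.str (red (Ideal.Quotient.mk _ r)) := by
  rw [← Hom.map_str f]
  change _ = reduction p _ (red.symm (red (Ideal.Quotient.mk _ r)))
  rw [red.symm_apply_apply]
  rfl

/-- The map from `R₀` fixes the reduction of any morphism, whatever the `δ`-structure on `R`. This
is why `(T - S) / p` makes sense. -/
theorem dvd_ringHom_sub_ofLift {B : PrismOver p δA R₀} (f : ofLift hA hR red δ h ⟶ B)
    (f' : ofLift hA hR red δ' h' ⟶ B) (r : R) :
    (p : B.carrier) ∣ Hom.ringHom f r - Hom.ringHom f' r := by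
  rw [← Ideal.mem_span_singleton, ← Ideal.Quotient.eq, mk_ringHom_ofLift, mk_ringHom_ofLift]

end OfLift

section Coproduct

variable [Fact p.Prime] {R : Type u} [CommRing R] [Algebra A R] (hA : IsCrystalline p A)
  (hR : IsPCompletelySmooth p A R) (red : (R ⧸ Ideal.span {(p : R)}) ≃ₐ[A] R₀)
  {d : ℕ} {T : Fin d → R} (hT : IsEtaleCoordinates p A T) {J : Type}
  (δ : Option J → DeltaStructure p R) (hδA : ∀ i, (δ i).IsCompatible δA)
  (hδ : ∀ i i' x, (p : R) ∣ (δ i).δ x - (δ i').δ x)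

include hT hδ in
/-- Given a `p`-complete free pd-algebra `D` over `R` with variables `w`, there is a coproduct of
copies of `R`, with different `δ`-structures, which has `D` as underlying ring. -/
theorem exists_coproduct_of_isPDPoly {D : Type u} [CommRing D] [Algebra A D] (f : R →ₐ[A] D)
    (w : J × Fin d → D) (hD : IsPDPoly p (f : R →+* D) w)
    (hfrob : ∀ F : D →+* D, (∀ r, (p : D) ∣ F (f r) - f r ^ p) → (∀ s, (p : D) ∣ F (w s)) →
      ∀ x, (p : D) ∣ F x - x ^ p) :
    ∃ (E : PrismOver p δA R₀) (ι : ∀ i, ofLift hA hR red (δ i) (hδA i) ⟶ E)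
      (v : J × Fin d → E.carrier),
      (∀ j k, p * v (j, k) = Hom.ringHom (ι none) (T k) - Hom.ringHom (ι (some j)) (T k)) ∧
      IsPDPoly p (Hom.ringHom (ι none)) v ∧
      (∀ (B : PrismOver p δA R₀) (g : ∀ i, ofLift hA hR red (δ i) (hδA i) ⟶ B),
        ∃ h : E ⟶ B, ∀ i, ι i ≫ h = g i) ∧
      ∀ (B : PrismOver p δA R₀) (h h' : E ⟶ B), (∀ i, ι i ≫ h = ι i ≫ h') → h = h' := by
  have hDc := hD.crystalline
  -- the legs
  have hleg : ∀ i : Option J, ∃ l : R →ₐ[A] D, (∀ r, (p : D) ∣ f r - l r) ∧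
      (i = none → l = f) ∧ ∀ j, i = some j → ∀ k, l (T k) = f (T k) - p * w (j, k) := by
    rintro (_ | j)
    · exact ⟨f, fun r => by simp, fun _ => rfl, fun _ h => by cases h⟩
    -- The values on `T` are dictated by the intended meaning of `w_j` as the divided difference of
    -- coordinates.
    · obtain ⟨l, h₁, h₂⟩ := hT.exists_lift hDc ((Ideal.Quotient.mkₐ A _).comp f)
        (fun k => f (T k) - p * w (j, k)) (fun k => by
          change _ = Ideal.Quotient.mk _ (f (T k))
          rw [Ideal.Quotient.eq, Ideal.mem_span_singleton]
          exact ⟨-w (j, k), by ring⟩)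
      refine ⟨l, fun r => ?_, fun h => (by cases h), fun j' hj => ?_⟩
      · rw [← Ideal.mem_span_singleton, ← Ideal.Quotient.eq, h₁]
        rfl
      · cases hj
        exact h₂
  choose l hlmod hlnone hlsome using hleg
  have hl0 : l none = f := hlnone none rfl
  have hlT : ∀ j k, p * w (j, k) = l none (T k) - l (some j) (T k) := fun j k => by
    rw [hl0, hlsome (some j) j rfl]
    ring
  have hlmod' : ∀ i i' r, (p : D) ∣ l i r - l i' r := fun i i' r => by
    simpa using (hlmod i' r).sub (hlmod i r)
  -- the Frobenius
  have hu : ∀ s : J × Fin d, (p : D) ^ 2 ∣ l none ((δ none).frobenius (T s.2)) -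
      l (some s.1) ((δ (some s.1)).frobenius (T s.2)) := fun s =>
    DeltaStructure.sq_dvd_map_frobenius_sub (l none : R →+* D) (l (some s.1) : R →+* D)
      (hδ _ _) (hlmod' _ _) _
  choose u hu using hu
  -- The value `p u` is forced: applying Frobenius to `p w = l_0 T - l_j T` must give the difference
  -- of the two Frobenius images, which is `p² u`.
  obtain ⟨F, hFf, hFw⟩ := hD.exists_lift hDc ((f : R →+* D).comp (δ none).frobenius)
    (fun s => p * u s) (fun s => hDc.hasDividedPowers_mul _)
  have hFf' : ∀ r, F (f r) = f ((δ none).frobenius r) := hFf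
  have hF : ∀ x, (p : D) ∣ F x - x ^ p := hfrob F
    (fun r => ⟨f ((δ none).δ r), by
      rw [hFf', DeltaStructure.frobenius_apply]
      simp⟩)
    (fun s => ⟨u s, hFw s⟩)
  let δD := DeltaStructure.ofFrobenius hDc F hF
  have hδD : δD.frobenius = F := DeltaStructure.frobenius_ofFrobenius hDc F hF
  have hFA : ∀ a, F (algebraMap A D a) = algebraMap A D (δA.frobenius a) := fun a => by
    rw [← f.commutes, hFf', (hδA none).frobenius_algebraMap, f.commutes]
  have hcompat : δD.IsCompatible δA := fun a => hDc.p_cancel <| by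
    have := hFA a
    rw [← hδD, DeltaStructure.frobenius_apply, DeltaStructure.frobenius_apply] at this
    simpa using this
  -- For the other legs both sides agree on `A`, reduce modulo `p` to the `p`-th power, and agree on
  -- `T` by the choice of `u`; étale coordinates do the rest.
  have hFl : ∀ i r, F (l i r) = l i ((δ i).frobenius r) := by
    rintro (_ | j) r
    · rw [hl0, hFf']
    · refine RingHom.congr_fun (hT.hom_ext hDc (F.comp (l (some j) : R →+* D))
        ((l (some j) : R →+* D).comp (δ (some j)).frobenius) (fun a => ?_) (fun r => ?_)
        (fun k => ?_)) r
      · change F (l _ _) = l _ ((δ (some j)).frobenius _)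
        rw [(hδA (some j)).frobenius_algebraMap, AlgHom.commutes, AlgHom.commutes, hFA]
      · change _ ∣ F (l _ _) - l _ ((δ (some j)).frobenius _)
        rw [DeltaStructure.frobenius_apply]
        convert (hF (l (some j) r)).sub (dvd_mul_right (p : D) (l (some j) ((δ (some j)).δ r)))
          using 1
        simp only [map_add, map_pow, map_mul, map_natCast]
        ring
      · change F (l _ _) = l _ ((δ (some j)).frobenius _)
        have h₁ := hu (j, k)
        have h₂ := congrArg F (hlT j k)
        rw [map_mul, map_natCast, hFw, map_sub, hl0, hFf'] at h₂
        rw [hl0] at h₁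
        linear_combination h₁ + h₂
  -- the prism
  let ψ₀ : R ⧸ Ideal.span {(p : R)} →ₐ[A] D ⧸ Ideal.span {(p : D)} :=
    Ideal.Quotient.liftₐ (Ideal.span {(p : R)}) ((Ideal.Quotient.mkₐ A _).comp f)
      (fun a ha => by
        obtain ⟨b, rfl⟩ := Ideal.mem_span_singleton'.mp ha
        rw [map_mul, map_natCast, Ideal.Quotient.natCast_span_self, mul_zero])
  let ψ : R₀ →ₐ[A] D ⧸ Ideal.span {(p : D)} := ψ₀.comp red.symm.toAlgHom
  have hψ : ∀ r, ψ (red (Ideal.Quotient.mk _ r)) = Ideal.Quotient.mk _ (f r) := fun r =>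
    congrArg ψ₀ (red.symm_apply_apply _)
  let E : PrismOver p δA R₀ :=
    { carrier := D, delta := δD, compat := hcompat, crystalline := hDc, str := ψ }
  let ι : ∀ i, ofLift hA hR red (δ i) (hδA i) ⟶ E := fun i =>
    show Hom _ _ from
    { toAlgHom := l i
      map_delta := fun r =>
        (DeltaStructure.map_delta_iff hDc (δ i) δD (l i : R →+* D) r).mpr <| by
          rw [hδD]
          exact (hFl i r).symm
      map_str := fun r => by
        obtain ⟨r, rfl⟩ := red.surjective r
        obtain ⟨r, rfl⟩ := Ideal.Quotient.mk_surjective r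
        change reduction p _ (red.symm (red _)) = ψ _
        rw [red.symm_apply_apply, hψ]
        change Ideal.Quotient.mk _ (l i r) = _
        rw [Ideal.Quotient.eq, Ideal.mem_span_singleton]
        have := hlmod' i none r
        rwa [hl0] at this }
  have hι : ∀ i r, Hom.ringHom (ι i) r = l i r := fun _ _ => rfl
  have hι0 : Hom.ringHom (ι none) = (f : R →+* D) := by
    ext r
    exact AlgHom.congr_fun hl0 r
  refine ⟨E, ι, w, hlT, hι0 ▸ hD, fun B g => ?_, fun B h h' hh => ?_⟩
  · have hBc := B.crystalline
    let G : ∀ i, R →+* B.carrier := fun i => Hom.ringHom (g i)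
    have hG : ∀ i i' r, (p : B.carrier) ∣ G i r - G i' r := fun i i' =>
      dvd_ringHom_sub_ofLift (g i) (g i')
    have hy : ∀ s : J × Fin d, (p : B.carrier) ∣
        G none (T s.2) - G (some s.1) (T s.2) :=
      fun s => hG _ _ _
    choose y hy using hy
    have hφg : ∀ i r, G i ((δ i).frobenius r) =
        B.delta.frobenius (G i r) := fun i => Hom.frobenius (g i)
    -- Here `p φ y` is a difference of Frobenius images, hence divisible by `p²`, so `p ∣ φ y`.
    have hdy : ∀ s, HasDividedPowers (y s) := fun s => by
      obtain ⟨z, hz⟩ := DeltaStructure.sq_dvd_map_frobenius_sub (G none)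
        (G (some s.1)) (hδ _ _) (hG _ _) (T s.2)
      apply B.delta.hasDividedPowers_of_dvd_frobenius hBc
      refine ⟨z, hBc.p_cancel ?_⟩
      rw [← mul_assoc, ← pow_two, ← hz, hφg, hφg, ← map_sub, hy, map_mul, map_natCast]
    obtain ⟨h, h₁, h₂⟩ := hD.exists_lift hBc (G none) y hdy
    have h₁' : ∀ r, h (f r) = G none r := h₁
    have hA' : ∀ a, h (algebraMap A D a) = algebraMap A _ a := fun a => by
      rw [← f.commutes, h₁']
      exact Hom.ringHom_algebraMap (g none) a
    have hlg : ∀ i r, h (l i r) = G i r := by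
      rintro (_ | j) r
      · rw [hl0, h₁']
      · refine RingHom.congr_fun (hT.hom_ext hBc (h.comp (l (some j) : R →+* D))
          (G (some j)) (fun a => ?_) (fun r => ?_) (fun k => ?_)) r
        · change h (l _ _) = _
          rw [AlgHom.commutes, hA']
          exact (Hom.ringHom_algebraMap (g (some j)) a).symm
        · change _ ∣ h (l _ _) - _
          have e₁ := map_dvd h (hlmod' (some j) none r)
          have e₂ := hG none (some j) r
          rw [map_natCast, map_sub, hl0, h₁'] at e₁
          have e₃ := e₁.add e₂
          rwa [sub_add_sub_cancel] at e₃
        · change h (l _ _) = _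
          have e₁ := congrArg h (hlT j k)
          rw [map_mul, map_natCast, h₂, ← hy, map_sub, hl0, h₁'] at e₁
          linear_combination e₁
    -- On the variables, multiply by `p`: then `p w` is a difference of leg values, and on the legs
    -- both Frobenius maps are known.
    have hFh : h.comp F = B.delta.frobenius.comp h := by
      refine hD.hom_ext hBc _ _ (fun r => ?_) (fun s => ?_)
      · change h (F (f r)) = B.delta.frobenius (h (f r))
        rw [hFf', h₁', h₁', hφg]
      · change h (F (w s)) = B.delta.frobenius (h (w s))
        apply hBc.p_cancel
        have e₁ := congrArg (fun x => B.delta.frobenius (h x)) (hlT s.1 s.2)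
        have e₂ := congrArg (fun x => h (F x)) (hlT s.1 s.2)
        simp only [map_mul, map_natCast, map_sub, hlg, hFl, hφg] at e₁ e₂
        rw [e₁, e₂]
    refine ⟨show Hom _ _ from
      { toAlgHom := { h with commutes' := hA' }
        map_delta := fun x =>
          (DeltaStructure.map_delta_iff hBc δD B.delta h x).mpr <| by
            rw [hδD]
            exact RingHom.congr_fun hFh x
        map_str := fun r => by
          obtain ⟨r, rfl⟩ := red.surjective r
          obtain ⟨r, rfl⟩ := Ideal.Quotient.mk_surjective r
          have hr : Ideal.Quotient.mk (Ideal.span {(p : B.carrier)}) (h (f r)) =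
              B.str (red (Ideal.Quotient.mk _ r)) := by
            rw [h₁']
            exact mk_ringHom_ofLift (g none) r
          change reduction p _ (ψ _) = _
          rw [hψ, ← hr]
          rfl }, fun i => Hom.ext_ringHom (hlg i)⟩
  · have hlh : ∀ i r, Hom.ringHom h (l i r) = Hom.ringHom h' (l i r) := fun i r =>
      congrArg (fun q => Hom.ringHom q r) (hh i)
    refine Hom.ext_ringHom (RingHom.congr_fun (hD.hom_ext B.crystalline _ _
      (fun r => ?_) (fun s => ?_)))
    · have := hlh none r
      rwa [hl0] at this
    · apply B.crystalline.p_cancel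
      have e₁ := congrArg (Hom.ringHom h) (hlT s.1 s.2)
      have e₂ := congrArg (Hom.ringHom h') (hlT s.1 s.2)
      rw [map_mul, map_natCast, map_sub] at e₁ e₂
      rw [hlh, hlh, ← e₂] at e₁
      exact e₁

include hT hδ in
theorem exists_coproduct :
    ∃ (E : PrismOver p δA R₀) (ι : ∀ i, ofLift hA hR red (δ i) (hδA i) ⟶ E)
      (v : J × Fin d → E.carrier),
      (∀ j k, p * v (j, k) = Hom.ringHom (ι none) (T k) - Hom.ringHom (ι (some j)) (T k)) ∧
      IsPDPoly p (Hom.ringHom (ι none)) v ∧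
      (∀ (B : PrismOver p δA R₀) (g : ∀ i, ofLift hA hR red (δ i) (hδA i) ⟶ B),
        ∃ h : E ⟶ B, ∀ i, ι i ≫ h = g i) ∧
      ∀ (B : PrismOver p δA R₀) (h h' : E ⟶ B), (∀ i, ι i ≫ h = ι i ≫ h') → h = h' := by
  let := ((algebraMap R (PDPoly p R (J × Fin d))).comp (algebraMap A R)).toAlgebra
  exact exists_coproduct_of_isPDPoly hA hR red hT δ hδA hδ
    { algebraMap R (PDPoly p R (J × Fin d)) with commutes' := fun _ => rfl } (PDPoly.X p R)
    (PDPoly.isPDPoly (hR.isCrystalline hA)) (PDPoly.dvd_sub_pow (hR.isCrystalline hA))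

end Coproduct

end PrismOver

/-! ### Coproducts and nerves from explicit universal properties. -/

section UniversalCoproduct

variable {C : Type*} [Category C]

theorem hasCoproduct_of_universal {K : Type} (X : K → C) {E : C} (ι : ∀ k, X k ⟶ E)
    (hex : ∀ (B : C) (g : ∀ k, X k ⟶ B), ∃ h : E ⟶ B, ∀ k, ι k ≫ h = g k)
    (hext : ∀ (B : C) (h h' : E ⟶ B), (∀ k, ι k ≫ h = ι k ≫ h') → h = h') :
    HasCoproduct X :=
  HasColimit.mk ⟨Cofan.mk E ι, Cofan.IsColimit.mk _ (fun s => (hex s.pt s.inj).choose)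
    (fun s k => (hex s.pt s.inj).choose_spec k)
    (fun s _ hm => hext _ _ _ fun k => (hm k).trans ((hex s.pt s.inj).choose_spec k).symm)⟩

theorem exists_iso_sigma {K : Type} (X : K → C) {E : C} (ι : ∀ k, X k ⟶ E)
    (hex : ∀ (B : C) (g : ∀ k, X k ⟶ B), ∃ h : E ⟶ B, ∀ k, ι k ≫ h = g k)
    (hext : ∀ (B : C) (h h' : E ⟶ B), (∀ k, ι k ≫ h = ι k ≫ h') → h = h')
    [HasCoproduct X] : ∃ α : E ≅ ∐ X, ∀ k, ι k ≫ α.hom = Sigma.ι X k := by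
  obtain ⟨h, hh⟩ := hex _ (Sigma.ι X)
  refine ⟨⟨h, Sigma.desc ι, hext _ _ _ fun k => ?_, Sigma.hom_ext _ _ fun k => ?_⟩, hh⟩
  · rw [← Category.assoc, hh, Sigma.ι_desc, Category.comp_id]
  · rw [← Category.assoc, Sigma.ι_desc, hh, Category.comp_id]

theorem hasBinaryCoproduct_of_universal {X Y E : C} (i : X ⟶ E) (j : Y ⟶ E)
    (hex : ∀ (B : C) (f : X ⟶ B) (g : Y ⟶ B), ∃ h : E ⟶ B, i ≫ h = f ∧ j ≫ h = g)
    (hext : ∀ (B : C) (h h' : E ⟶ B), i ≫ h = i ≫ h' → j ≫ h = j ≫ h' → h = h') :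
    HasBinaryCoproduct X Y :=
  HasColimit.mk ⟨BinaryCofan.mk i j, BinaryCofan.isColimitMk
    (fun s => (hex s.pt s.inl s.inr).choose)
    (fun s => (hex s.pt s.inl s.inr).choose_spec.1)
    (fun s => (hex s.pt s.inl s.inr).choose_spec.2)
    (fun s _ h₁ h₂ => hext _ _ _ (h₁.trans (hex s.pt s.inl s.inr).choose_spec.1.symm)
      (h₂.trans (hex s.pt s.inl s.inr).choose_spec.2.symm))⟩

theorem exists_iso_coprod {X Y E : C} (i : X ⟶ E) (j : Y ⟶ E)
    (hex : ∀ (B : C) (f : X ⟶ B) (g : Y ⟶ B), ∃ h : E ⟶ B, i ≫ h = f ∧ j ≫ h = g)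
    (hext : ∀ (B : C) (h h' : E ⟶ B), i ≫ h = i ≫ h' → j ≫ h = j ≫ h' → h = h')
    [HasBinaryCoproduct X Y] :
    ∃ α : E ≅ X ⨿ Y, i ≫ α.hom = coprod.inl ∧ j ≫ α.hom = coprod.inr := by
  obtain ⟨h, h₁, h₂⟩ := hex _ (coprod.inl : X ⟶ X ⨿ Y) coprod.inr
  refine ⟨⟨h, coprod.desc i j, hext _ _ _ ?_ ?_, coprod.hom_ext ?_ ?_⟩, h₁, h₂⟩
  · rw [← Category.assoc, h₁, coprod.inl_desc, Category.comp_id]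
  · rw [← Category.assoc, h₂, coprod.inr_desc, Category.comp_id]
  · rw [← Category.assoc, coprod.inl_desc, h₁, Category.comp_id]
  · rw [← Category.assoc, coprod.inr_desc, h₂, Category.comp_id]

theorem selfNerveι_map (X : C) (h : ∀ n : ℕ, HasCoproduct (fun _ : Fin (n + 1) => X)) {m n : ℕ}
    (f : SimplexCategory.mk m ⟶ SimplexCategory.mk n) (j : Fin (m + 1)) :
    selfNerveι X h m j ≫ (selfNerve X h).map f = selfNerveι X h n (f.toOrderHom j) := by
  have := h m
  have := h n
  exact Sigma.ι_desc _ _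

theorem mixedNerveι_map (P X : C) (h : ∀ n : ℕ, HasCoproduct (mixedFamily P X n)) {m n : ℕ}
    (f : SimplexCategory.mk m ⟶ SimplexCategory.mk n) (j : Fin (m + 1)) :
    mixedNerveι P X h m j ≫ (mixedNerve P X h).map f = mixedNerveι P X h n (f.toOrderHom j) := by
  have := h m
  have := h n
  exact Sigma.ι_desc (mixedLeg P X n f.toOrderHom) (some j)

theorem mixedNerveBase_map (P X : C) (h : ∀ n : ℕ, HasCoproduct (mixedFamily P X n)) {m n : ℕ}
    (f : SimplexCategory.mk m ⟶ SimplexCategory.mk n) :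
    mixedNerveBase P X h m ≫ (mixedNerve P X h).map f = mixedNerveBase P X h n := by
  have := h m
  have := h n
  exact Sigma.ι_desc (mixedLeg P X n f.toOrderHom) none

end UniversalCoproduct

/-! ### Transport of cosimplicial rings. -/

namespace CosimplicialStructure

variable {p : ℕ} {A : Type u} [CommRing A] {δA : DeltaStructure p A}
  {R₀ : Type u} [CommRing R₀] [Algebra A R₀]

/-- Transport of the structure of a cosimplicial ring along isomorphisms in each degree. -/
theorem exists_of_ringEquiv (N : CosimplicialObject (PrismOver p δA R₀)) {S : ℕ → Type u}
    [∀ n, CommRing (S n)] (E : ∀ n : SimplexCategory, S n.len ≃+* (N.obj n).carrier) :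
    ∃ (M : CosimplicialStructure S) (e : M.toCosimplicialObject ≅ N ⋙ PrismOver.forgetToRing),
      (∀ {m n : SimplexCategory} (f : m ⟶ n) x,
        E n (M.map f x) = PrismOver.Hom.ringHom (N.map f) (E m x)) ∧
      ∀ n x, M.component e.hom n x = E (SimplexCategory.mk n) x := by
  let M : CosimplicialStructure S :=
    { map := fun {m n} f => ((E n).symm : _ →+* S n.len).comp
        ((PrismOver.Hom.ringHom (N.map f)).comp (E m : S m.len →+* _))
      map_id := fun n => by
        ext x
        simp only [RingHom.comp_apply, RingHom.coe_coe, N.map_id]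
        exact (E n).symm_apply_apply x
      map_comp := fun f g => by
        ext x
        simp only [RingHom.comp_apply, RingHom.coe_coe, N.map_comp, RingEquiv.apply_symm_apply]
        rfl }
  have hM : ∀ {m n : SimplexCategory} (f : m ⟶ n) x,
      E n (M.map f x) = PrismOver.Hom.ringHom (N.map f) (E m x) := fun f x => by simp [M]
  let e : M.toCosimplicialObject ≅ N ⋙ PrismOver.forgetToRing :=
    NatIso.ofComponents (fun n => (E n).toCommRingCatIso) (fun f => by
      ext x
      exact hM f x)
  exact ⟨M, e, hM, fun _ _ => rfl⟩

end CosimplicialStructure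

/-! ### Face and degeneracy formulas on variables, and uniqueness of the structure maps. -/

section Variables

variable {p : ℕ} {R : Type u} [CommRing R] {d : ℕ}

/-- The default value at `j = 0` matches `(T_0 - T_0) / p`, so `X_j ↦ X_{θ j} - X_{θ 0}` covers all
structure maps at once. -/
theorem pdVar_zero (n : ℕ) (k : Fin d) : pdVar p R d n 0 k = 0 := by
  simp [pdVar]

theorem pdVar_succ (n : ℕ) (j : Fin n) (k : Fin d) :
    pdVar p R d n (j + 1) k = PDPoly.X p R (j, k) := by
  rw [pdVar, dif_pos (by omega)]
  rfl

/-- The injection omitting `i` sends `0` to `1` if `i = 0` and to `0` otherwise, so the correction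
term is `X_1` or `X_0 = 0`. -/
theorem faceOnVars_of_succAbove {n : ℕ} {i : Fin (n + 2)}
    {f : PDModel p R d n →+* PDModel p R d (n + 1)}
    (h : ∀ (j : Fin (n + 1)) k, f (pdVar p R d n j k) =
      pdVar p R d (n + 1) (i.succAbove j) k - pdVar p R d (n + 1) (i.succAbove 0) k) :
    FaceOnVars p R d n i f := by
  intro j k hj hjn
  have hval : ∀ l : Fin (n + 1), ((i.succAbove l : Fin (n + 2)) : ℕ) =
      if (l : ℕ) < i then (l : ℕ) else l + 1 := fun l => by
    rw [Fin.succAbove]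
    simp only [Fin.lt_def, Fin.val_castSucc]
    split_ifs <;> simp
  have := h ⟨j, by omega⟩ k
  rw [hval, hval] at this
  simp only [Fin.val_zero] at this
  rw [this]
  rcases Nat.eq_zero_or_pos (i : ℕ) with hi | hi
  · simp only [hi, Nat.not_lt_zero, if_false, if_true, zero_add]
  · have hi' : 0 < (i : ℕ) := hi
    simp only [hi', hi'.ne', if_true, if_false, pdVar_zero, sub_zero]
    by_cases hij : j < i
    · rw [if_pos hij, if_neg (by omega)]
    · rw [if_neg hij, if_pos (by omega)]

/-- A surjection fixes `0`, so there is no correction term; the exceptional case `(i, j) = (0, 1)`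
is `X_0 = 0`. -/
theorem degeneracy_onVars_of_predAbove {n : ℕ} {i : Fin (n + 1)}
    {f : PDModel p R d (n + 1) →+* PDModel p R d n}
    (h : ∀ (j : Fin (n + 2)) k, f (pdVar p R d (n + 1) j k) =
      pdVar p R d n (i.predAbove j) k - pdVar p R d n (i.predAbove 0) k) (j : ℕ) (k : Fin d)
    (hj : 1 ≤ j) (hjn : j ≤ n + 1) :
    f (pdVar p R d (n + 1) j k) =
      if (i : ℕ) = 0 ∧ j = 1 then 0
      else if (i : ℕ) < j then pdVar p R d n (j - 1) k
      else pdVar p R d n j k := by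
  have hval : ∀ l : Fin (n + 2), ((i.predAbove l : Fin (n + 1)) : ℕ) =
      if (i : ℕ) < l then (l : ℕ) - 1 else l := fun l => by
    rw [Fin.predAbove]
    simp only [Fin.lt_def, Fin.val_castSucc]
    split_ifs <;> simp
  have := h ⟨j, by omega⟩ k
  rw [hval, hval] at this
  simp only [Fin.val_zero] at this
  rw [this]
  rcases eq_or_ne j 1 with rfl | hj1
  · rcases eq_or_ne (i : ℕ) 0 with hi | hi
    · simp [hi, pdVar_zero]
    · simp [hi, pdVar_zero]
  · simp only [hj1, and_false, if_false, Nat.not_lt_zero, pdVar_zero, sub_zero]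
    split_ifs <;> rfl

variable [Fact p.Prime] {B : Type u} [CommRing B]

theorem PDModel.hom_ext (hR : IsCrystalline p R) (hB : IsCrystalline p B) {n : ℕ}
    {f g : PDModel p R d n →+* B} (h₁ : ∀ r, f (algebraMap R _ r) = g (algebraMap R _ r))
    (h₂ : ∀ (j : ℕ) k, 1 ≤ j → j ≤ n → f (pdVar p R d n j k) = g (pdVar p R d n j k)) :
    f = g :=
  (PDPoly.isPDPoly hR).hom_ext hB f g h₁ fun s => by
    obtain ⟨j, k⟩ := s
    rw [← pdVar_succ]
    exact h₂ _ _ (by omega) (by omega)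

theorem IsDegeneracy.unique (hR : IsCrystalline p R) {n : ℕ} {i : Fin (n + 1)}
    {f g : PDModel p R d (n + 1) →+* PDModel p R d n} (hf : IsDegeneracy p R d n i f)
    (hg : IsDegeneracy p R d n i g) : f = g :=
  PDModel.hom_ext hR (PDPoly.crystalline hR) (fun r => by rw [hf.onBase, hg.onBase])
    fun j k h₁ h₂ => by rw [hf.onVars j k h₁ h₂, hg.onVars j k h₁ h₂]

theorem FaceOnVars.hom_ext (hR : IsCrystalline p R) {n : ℕ} {i : Fin (n + 2)}
    {f g : PDModel p R d n →+* PDModel p R d (n + 1)}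
    (h : ∀ r, f (algebraMap R _ r) = g (algebraMap R _ r)) (hf : FaceOnVars p R d n i f)
    (hg : FaceOnVars p R d n i g) : f = g :=
  PDModel.hom_ext hR (PDPoly.crystalline hR) h
    fun j k h₁ h₂ => by rw [hf j k h₁ h₂, hg j k h₁ h₂]

/-- Only `i = 0` needs an argument: there the restriction to `R` is pinned down by étale
coordinates. -/
theorem IsSelfFace.unique {A : Type u} [CommRing A] [Algebra A R] (hR : IsCrystalline p R)
    {T : Fin d → R} (hT : IsEtaleCoordinates p A T) {n : ℕ} {i : Fin (n + 2)}
    {f g : PDModel p R d n →+* PDModel p R d (n + 1)} (hf : IsSelfFace p A T n i f)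
    (hg : IsSelfFace p A T n i g) : f = g := by
  refine FaceOnVars.hom_ext hR (fun r => ?_) hf.onVars hg.onVars
  rcases eq_or_ne (i : ℕ) 0 with hi | hi
  · refine RingHom.congr_fun (hT.hom_ext (PDPoly.crystalline hR) (f.comp (algebraMap R _))
      (g.comp (algebraMap R _)) (fun a => ?_) (fun r => ?_) (fun k => ?_)) r
    · exact (hf.onBase_zero_linear hi a).trans (hg.onBase_zero_linear hi a).symm
    · have h := Ideal.sub_mem _ (hf.onBase_zero_mod hi r) (hg.onBase_zero_mod hi r)
      rw [sub_sub_sub_cancel_right] at h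
      exact Ideal.mem_span_singleton.mp h
    · exact (hf.onCoord_zero hi k).trans (hg.onCoord_zero hi k).symm
  · rw [hf.onBase_succ hi, hg.onBase_succ hi]

/-- The base is itself a pd-algebra over `R₁` on `Y`, so values on `R₁` and `Y` determine the
restriction to it. -/
theorem IsMixedFace.unique {R₁ : Type u} [CommRing R₁] {inl : R₁ →+* R} {Y : Fin d → R}
    (hY : IsPDPoly p inl Y) {n : ℕ} {i : Fin (n + 2)}
    {f g : PDModel p R d n →+* PDModel p R d (n + 1)} (hf : IsMixedFace p inl Y n i f)
    (hg : IsMixedFace p inl Y n i g) : f = g := by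
  have hR := hY.crystalline
  refine FaceOnVars.hom_ext hR (fun r => ?_) hf.onVars hg.onVars
  refine RingHom.congr_fun (hY.hom_ext (PDPoly.crystalline hR) (f.comp (algebraMap R _))
    (g.comp (algebraMap R _)) (fun r => ?_) (fun k => ?_)) r
  · exact (hf.onBase r).trans (hg.onBase r).symm
  · exact (hf.onY k).trans (hg.onY k).symm

omit [Fact p.Prime] in
-- A unipotent linear change of variables, harmless since divided powers are stable under sums. It
-- passes from `(T - S_j) / p` to `Y` and `(S_0 - S_j) / p`.
theorem IsPDPoly.sum_elim_sub {D : Type u} [CommRing D] {f : R →+* D} {n : ℕ}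
    {w : Fin (n + 1) × Fin d → D} (hw : IsPDPoly p f w) :
    IsPDPoly p f (Sum.elim (fun k => w (0, k))
      (fun s : Fin n × Fin d => w (s.1.succ, s.2) - w (0, s.2))) where
  crystalline := hw.crystalline
  dividedPowers := by
    rintro (k | s)
    · exact hw.dividedPowers _
    · exact (hw.dividedPowers _).sub (hw.dividedPowers _)
  exists_lift {B} _ hB g y hy := by
    let z : Fin (n + 1) × Fin d → B := fun s =>
      (Fin.cons 0 (fun j => y (Sum.inr (j, s.2))) : Fin (n + 1) → B) s.1 + y (Sum.inl s.2)
    obtain ⟨h, h₁, h₂⟩ := hw.exists_lift hB g z (by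
      rintro ⟨j, k⟩
      refine .add ?_ (hy _)
      induction j using Fin.cases with
      | zero => exact .zero
      | succ j => exact hy _)
    refine ⟨h, h₁, ?_⟩
    rintro (k | s) <;> simp [h₂, z]
  hom_ext hB h h' h₁ h₂ := by
    refine hw.hom_ext hB h h' h₁ ?_
    have h₀ : ∀ k, h (w (0, k)) = h' (w (0, k)) := fun k => h₂ (Sum.inl k)
    rintro ⟨j, k⟩
    induction j using Fin.cases with
    | zero => exact h₀ k
    | succ j =>
      have := h₂ (Sum.inr (j, k))
      simpa [h₀] using this

end Variables

/-! ### The self-nerve. -/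

namespace PrismOver

variable {p : ℕ} [Fact p.Prime] {A : Type u} [CommRing A] {δA : DeltaStructure p A}
  {R₀ : Type u} [CommRing R₀] [Algebra A R₀] {R : Type u} [CommRing R] [Algebra A R]
  (hA : IsCrystalline p A) (hR : IsPCompletelySmooth p A R)
  (red : (R ⧸ Ideal.span {(p : R)}) ≃ₐ[A] R₀) {d : ℕ} {T : Fin d → R}
  (hT : IsEtaleCoordinates p A T)

section SelfNerve

variable (δ : DeltaStructure p R) (h : δ.IsCompatible δA)

include hT in
theorem exists_selfCoproduct (n : ℕ) :
    ∃ (E : PrismOver p δA R₀) (ι : Fin (n + 1) → (ofLift hA hR red δ h ⟶ E))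
      (v : Fin n × Fin d → E.carrier),
      (∀ j k, p * v (j, k) = Hom.ringHom (ι 0) (T k) - Hom.ringHom (ι j.succ) (T k)) ∧
      IsPDPoly p (Hom.ringHom (ι 0)) v ∧
      (∀ (B : PrismOver p δA R₀) (g : Fin (n + 1) → (ofLift hA hR red δ h ⟶ B)),
        ∃ h : E ⟶ B, ∀ i, ι i ≫ h = g i) ∧
      ∀ (B : PrismOver p δA R₀) (h h' : E ⟶ B), (∀ i, ι i ≫ h = ι i ≫ h') → h = h' := by
  obtain ⟨E, ι, v, h₁, h₂, h₃, h₄⟩ := exists_coproduct hA hR red hT (J := Fin n) (fun _ => δ)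
    (fun _ => h) (fun _ _ _ => by simp)
  have h0 : ι (finSuccEquiv n 0) = ι none := congrArg ι finSuccEquiv_zero
  have hs : ∀ j : Fin n, ι (finSuccEquiv n j.succ) = ι (some j) := fun j =>
    congrArg ι (finSuccEquiv_succ j)
  refine ⟨E, fun i => ι (finSuccEquiv n i), v, fun j k => ?_, ?_, fun B g => ?_,
    fun B f f' hf => h₄ B f f' fun i => ?_⟩
  · change _ = Hom.ringHom (ι (finSuccEquiv n 0)) _ - Hom.ringHom (ι (finSuccEquiv n j.succ)) _
    rw [h0, hs]
    exact h₁ j k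
  · change IsPDPoly p (Hom.ringHom (ι (finSuccEquiv n 0))) v
    rwa [h0]
  · obtain ⟨f, hf⟩ := h₃ B (fun i => g ((finSuccEquiv n).symm i))
    exact ⟨f, fun i => by rw [hf, Equiv.symm_apply_apply]⟩
  · simpa using hf ((finSuccEquiv n).symm i)

include hT in
theorem hasCoproduct_self (n : ℕ) :
    HasCoproduct (fun _ : Fin (n + 1) => ofLift hA hR red δ h) := by
  obtain ⟨E, ι, v, -, -, h₃, h₄⟩ := exists_selfCoproduct hA hR red hT δ h n
  exact hasCoproduct_of_universal _ ι h₃ h₄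

include hT in
theorem exists_isPDPoly_selfNerve
    (hP : ∀ n : ℕ, HasCoproduct (fun _ : Fin (n + 1) => ofLift hA hR red δ h)) (n : ℕ) :
    ∃ v : Fin n × Fin d → ((selfNerve _ hP).obj (SimplexCategory.mk n)).carrier,
      (∀ j k, p * v (j, k) = Hom.ringHom (selfNerveι _ hP n 0) (T k) -
        Hom.ringHom (selfNerveι _ hP n j.succ) (T k)) ∧
      IsPDPoly p (Hom.ringHom (selfNerveι _ hP n 0)) v := by
  obtain ⟨E, ι, v, h₁, h₂, h₃, h₄⟩ := exists_selfCoproduct hA hR red hT δ h n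
  have := hP n
  obtain ⟨α, hα⟩ := exists_iso_sigma _ ι h₃ h₄
  have hα' : ∀ i r, Hom.ringHom α.hom (Hom.ringHom (ι i) r) =
      Hom.ringHom (selfNerveι _ hP n i) r := fun i r =>
    congrArg (fun q => Hom.ringHom q r) (hα i)
  refine ⟨fun s => Hom.ringHom α.hom (v s), fun j k => ?_,
    h₂.map_ringEquiv (PrismOver.crystalline _) (ringEquivOfIso α) (hα' 0) (fun _ => rfl)⟩
  have e := congrArg (Hom.ringHom α.hom) (h₁ j k)
  rw [map_mul, map_natCast, map_sub] at e
  exact e.trans (congrArg₂ (· - ·) (hα' _ _) (hα' _ _))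

include hT in
theorem selfNerve_description :
    let P : PrismOver p δA R₀ := ofLift hA hR red δ h
    ∃ hP : ∀ n : ℕ, HasCoproduct (fun _ : Fin (n + 1) => P),
    ∃ M : CosimplicialStructure (PDModel p R d),
      (∀ n i f, f = M.face n i ↔ IsSelfFace p A T n i f) ∧
      (∀ n i f, f = M.degeneracy n i ↔ IsDegeneracy p R d n i f) ∧
      ∃ e : M.toCosimplicialObject ≅ selfNerve P hP ⋙ forgetToRing,
        ∀ n : ℕ,
          (∀ r : R, M.component e.hom n (algebraMap R _ r) =
            Hom.ringHom (selfNerveι P hP n 0) r) ∧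
          (∀ (j : Fin (n + 1)) (k : Fin d), j ≠ 0 →
            p * M.component e.hom n (pdVar p R d n j k) =
              Hom.ringHom (selfNerveι P hP n 0) (T k) -
                Hom.ringHom (selfNerveι P hP n j) (T k)) := by
  intro P
  have hRc := hR.isCrystalline hA
  have hP := hasCoproduct_self hA hR red hT δ h
  refine ⟨hP, ?_⟩
  have hE : ∀ n : ℕ, ∃ E : PDModel p R d n ≃+*
      ((selfNerve P hP).obj (SimplexCategory.mk n)).carrier,
      (∀ r : R, E (algebraMap R _ r) = Hom.ringHom (selfNerveι P hP n 0) r) ∧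
      ∀ (j : Fin (n + 1)) (k : Fin d), p * E (pdVar p R d n j k) =
        Hom.ringHom (selfNerveι P hP n 0) (T k) -
          Hom.ringHom (selfNerveι P hP n j) (T k) := fun n => by
    obtain ⟨v, h₁, h₂⟩ := exists_isPDPoly_selfNerve hA hR red hT δ h hP n
    obtain ⟨E, hE₁, hE₂⟩ := (PDPoly.isPDPoly hRc).exists_ringEquiv h₂
    refine ⟨E, hE₁, fun j k => ?_⟩
    induction j using Fin.cases with
    | zero => rw [Fin.val_zero, pdVar_zero, map_zero, mul_zero, sub_self]
    | succ j => rw [Fin.val_succ, pdVar_succ, hE₂, h₁]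
  choose E hE₁ hE₂ using hE
  obtain ⟨M, e, hM, he⟩ := CosimplicialStructure.exists_of_ringEquiv (selfNerve P hP)
    (S := PDModel p R d) (fun n => E n.len)
  have hι : ∀ {m n : ℕ} (θ : SimplexCategory.mk m ⟶ SimplexCategory.mk n) (j : Fin (m + 1))
      (r : R), Hom.ringHom ((selfNerve P hP).map θ) (Hom.ringHom (selfNerveι P hP m j) r) =
        Hom.ringHom (selfNerveι P hP n (θ.toOrderHom j)) r := fun θ j r =>
    congrArg (fun q => Hom.ringHom q r) (selfNerveι_map P hP θ j)
  have hMbase : ∀ {m n : ℕ} (θ : SimplexCategory.mk m ⟶ SimplexCategory.mk n) (r : R),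
      E n (M.map θ (algebraMap R (PDModel p R d m) r)) =
        Hom.ringHom (selfNerveι P hP n (θ.toOrderHom 0)) r := fun {m n} θ r => by
    rw [← hι, ← hE₁]
    exact hM θ _
  -- Apply `θ` to `p X_j = T_0 - T_j`: the result `T_{θ 0} - T_{θ j}` is `p (X_{θ j} - X_{θ 0})`,
  -- and `p` cancels.
  have hMvar : ∀ {m n : ℕ} (θ : SimplexCategory.mk m ⟶ SimplexCategory.mk n) (j : Fin (m + 1))
      (k : Fin d), M.map θ (pdVar p R d m j k) =
        pdVar p R d n (θ.toOrderHom j : Fin (n + 1)) k -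
          pdVar p R d n (θ.toOrderHom 0 : Fin (n + 1)) k := fun {m n} θ j k => by
    apply (E n).injective
    apply (PrismOver.crystalline _).p_cancel
    have e₁ := congrArg (Hom.ringHom ((selfNerve P hP).map θ)) (hE₂ m j k)
    rw [map_mul, map_natCast, map_sub, hι, hι] at e₁
    have e₂ : E n (M.map θ (pdVar p R d m j k)) = _ := hM θ _
    rw [e₂, map_sub, mul_sub, hE₂, hE₂]
    refine e₁.trans ?_
    ring
  have hface : ∀ n (i : Fin (n + 2)), IsSelfFace p A T n i (M.face n i) := fun n i =>
    { onBase_succ := fun hi r => (E (n + 1)).injective <| by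
        rw [hE₁]
        refine (hMbase (SimplexCategory.δ i) r).trans ?_
        congr 3
        exact Fin.succAbove_ne_zero_zero (fun hi' : i = 0 => hi (by rw [hi', Fin.val_zero]))
      onBase_zero_linear := fun hi a => (E (n + 1)).injective <| by
        rw [hE₁]
        refine (hMbase (SimplexCategory.δ i) _).trans ?_
        exact (Hom.ringHom_algebraMap _ a).trans (Hom.ringHom_algebraMap _ a).symm
      onBase_zero_mod := fun hi r => by
        rw [Ideal.mem_span_singleton, ← map_dvd_iff (E (n + 1)), map_natCast, map_sub, hE₁]
        have := hMbase (SimplexCategory.δ i) r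
        exact this ▸ dvd_ringHom_sub_ofLift _ _ _
      -- The `0`-th face moves the first copy to the second, and `T_1 = T_0 - p X_1`.
      onCoord_zero := fun hi k => (E (n + 1)).injective <| by
        have hi' : i = 0 := Fin.ext hi
        have e₁ := hE₂ (n + 1) 1 k
        rw [map_sub, map_mul, map_natCast, hE₁]
        refine (hMbase (SimplexCategory.δ i) _).trans ?_
        have e₂ : (SimplexCategory.δ i).toOrderHom 0 = (1 : Fin (n + 2)) := by
          rw [hi']
          rfl
        rw [e₂]
        have e₃ : ((1 : Fin (n + 2)) : ℕ) = 1 := rfl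
        rw [e₃] at e₁
        rw [e₁]
        ring
      onVars := faceOnVars_of_succAbove (hMvar (SimplexCategory.δ i)) }
  have hdeg : ∀ n (i : Fin (n + 1)), IsDegeneracy p R d n i (M.degeneracy n i) := fun n i =>
    { onBase := fun r => (E n).injective <| by
        rw [hE₁]
        refine (hMbase (SimplexCategory.σ i) r).trans ?_
        congr 2
      onVars := degeneracy_onVars_of_predAbove (hMvar (SimplexCategory.σ i)) }
  refine ⟨M, fun n i f => ⟨fun hf => hf ▸ hface n i, fun hf => hf.unique hRc hT (hface n i)⟩,
    fun n i f => ⟨fun hf => hf ▸ hdeg n i, fun hf => hf.unique hRc (hdeg n i)⟩, e,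
    fun n => ⟨fun r => ?_, fun j k _ => ?_⟩⟩
  · rw [he]
    exact hE₁ n r
  · rw [he]
    exact hE₂ n j k

end SelfNerve

end PrismOver

/-! ### The mixed nerve. -/

namespace PrismOver

variable {p : ℕ} [Fact p.Prime] {A : Type u} [CommRing A] {δA : DeltaStructure p A}
  {R₀ : Type u} [CommRing R₀] [Algebra A R₀] {R : Type u} [CommRing R] [Algebra A R]
  (hA : IsCrystalline p A) (hR : IsPCompletelySmooth p A R)
  (red : (R ⧸ Ideal.span {(p : R)}) ≃ₐ[A] R₀) {d : ℕ} {T : Fin d → R}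
  (hT : IsEtaleCoordinates p A T) (δ₁ δ₂ : DeltaStructure p R) (h₁ : δ₁.IsCompatible δA)
  (h₂ : δ₂.IsCompatible δA) (hδ : ∀ x : R, (p : R) ∣ δ₁.δ x - δ₂.δ x)

include hT hδ in
theorem exists_mixedCoproduct (J : Type) :
    ∃ (E : PrismOver p δA R₀) (β : ofLift hA hR red δ₁ h₁ ⟶ E)
      (ι : J → (ofLift hA hR red δ₂ h₂ ⟶ E)) (v : J × Fin d → E.carrier),
      (∀ j k, p * v (j, k) = Hom.ringHom β (T k) - Hom.ringHom (ι j) (T k)) ∧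
      IsPDPoly p (Hom.ringHom β) v ∧
      (∀ (B : PrismOver p δA R₀) (f : ofLift hA hR red δ₁ h₁ ⟶ B)
        (g : J → (ofLift hA hR red δ₂ h₂ ⟶ B)),
        ∃ h : E ⟶ B, β ≫ h = f ∧ ∀ i, ι i ≫ h = g i) ∧
      ∀ (B : PrismOver p δA R₀) (h h' : E ⟶ B), β ≫ h = β ≫ h' →
        (∀ i, ι i ≫ h = ι i ≫ h') → h = h' := by
  let Δ : Option J → DeltaStructure p R := fun i => i.elim δ₁ fun _ => δ₂
  have hΔA : ∀ i, (Δ i).IsCompatible δA := by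
    rintro (_ | j)
    · exact h₁
    · exact h₂
  have hΔ : ∀ i i' x, (p : R) ∣ (Δ i).δ x - (Δ i').δ x := by
    rintro (_ | j) (_ | j') x
    · simp
    · exact hδ x
    · rw [← neg_sub, dvd_neg]
      exact hδ x
    · simp [Δ]
  obtain ⟨E, ι, v, e₁, e₂, e₃, e₄⟩ := exists_coproduct hA hR red hT Δ hΔA hΔ
  refine ⟨E, ι none, fun j => ι (some j), v, e₁, e₂, fun B f g => ?_,
    fun B h h' h₀ hs => e₄ B h h' ?_⟩
  · obtain ⟨h, hh⟩ := e₃ B (fun i => match i with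
      | none => f
      | some j => g j)
    exact ⟨h, hh none, fun j => hh (some j)⟩
  · rintro (_ | j)
    · exact h₀
    · exact hs j

include hT hδ in
theorem hasBinaryCoproduct_ofLift :
    HasBinaryCoproduct (ofLift hA hR red δ₁ h₁) (ofLift hA hR red δ₂ h₂) := by
  obtain ⟨E, β, ι, v, -, -, h₃, h₄⟩ :=
    exists_mixedCoproduct hA hR red hT δ₁ δ₂ h₁ h₂ hδ Unit
  refine hasBinaryCoproduct_of_universal β (ι ()) (fun B f g => ?_)
    (fun B h h' e₁ e₂ => h₄ B h h' e₁ fun _ => e₂)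
  obtain ⟨h, e₁, e₂⟩ := h₃ B f fun _ => g
  exact ⟨h, e₁, e₂ ()⟩

include hT hδ in
theorem exists_isPDPoly_coprod
    [HasBinaryCoproduct (ofLift hA hR red δ₁ h₁) (ofLift hA hR red δ₂ h₂)] :
    ∃ Y : Fin d → (ofLift hA hR red δ₁ h₁ ⨿ ofLift hA hR red δ₂ h₂).carrier,
      (∀ k, p * Y k =
        Hom.ringHom (coprod.inl : ofLift hA hR red δ₁ h₁ ⟶
          ofLift hA hR red δ₁ h₁ ⨿ ofLift hA hR red δ₂ h₂) (T k) -
        Hom.ringHom (coprod.inr : ofLift hA hR red δ₂ h₂ ⟶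
          ofLift hA hR red δ₁ h₁ ⨿ ofLift hA hR red δ₂ h₂) (T k)) ∧
      IsPDPoly p (Hom.ringHom (coprod.inl : ofLift hA hR red δ₁ h₁ ⟶
          ofLift hA hR red δ₁ h₁ ⨿ ofLift hA hR red δ₂ h₂)) Y := by
  obtain ⟨E, β, ι, v, e₁, e₂, h₃, h₄⟩ :=
    exists_mixedCoproduct hA hR red hT δ₁ δ₂ h₁ h₂ hδ Unit
  obtain ⟨α, hα₁, hα₂⟩ := exists_iso_coprod β (ι ())
    (fun B f g => by
      obtain ⟨h, e₁, e₂⟩ := h₃ B f fun _ => g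
      exact ⟨h, e₁, e₂ ()⟩)
    (fun B h h' e₁ e₂ => h₄ B h h' e₁ fun _ => e₂)
  have e₂' := e₂.reindex (Equiv.punitProd (Fin d)).symm
  refine ⟨fun k => Hom.ringHom α.hom (v ((), k)), fun k => ?_,
    e₂'.map_ringEquiv (PrismOver.crystalline _) (ringEquivOfIso α)
      (fun r => congrArg (fun q => Hom.ringHom q r) hα₁) (fun _ => rfl)⟩
  have e := congrArg (Hom.ringHom α.hom) (e₁ () k)
  rw [map_mul, map_natCast, map_sub] at e
  exact e.trans (congrArg₂ (· - ·) (congrArg (fun q => Hom.ringHom q (T k)) hα₁)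
    (congrArg (fun q => Hom.ringHom q (T k)) hα₂))

/-- The coprojections of a cocone on `mixedFamily`. -/
def mixedCofan {C : Type*} [Category C] {P X E : C} {n : ℕ} (β : P ⟶ E)
    (ι : Fin (n + 1) → (X ⟶ E)) : ∀ i, mixedFamily P X n i ⟶ E
  | none => β
  | some j => ι j

include hT hδ in
-- The legs occur both as a family over `mixedFamily`, for the universal property, and as `β` and
-- `γ`, whose sources are visibly the two lifts so that they can be evaluated on `R`.
theorem exists_mixedFamily_coproduct (n : ℕ) :
    ∃ (E : PrismOver p δA R₀)
      (ι : ∀ i, mixedFamily (ofLift hA hR red δ₁ h₁) (ofLift hA hR red δ₂ h₂) n i ⟶ E)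
      (β : ofLift hA hR red δ₁ h₁ ⟶ E) (γ : Fin (n + 1) → (ofLift hA hR red δ₂ h₂ ⟶ E))
      (v : Fin (n + 1) × Fin d → E.carrier),
      ι = mixedCofan β γ ∧
      (∀ j k, p * v (j, k) = Hom.ringHom β (T k) - Hom.ringHom (γ j) (T k)) ∧
      IsPDPoly p (Hom.ringHom β) v ∧
      (∀ (B : PrismOver p δA R₀) (g : ∀ i, mixedFamily (ofLift hA hR red δ₁ h₁)
        (ofLift hA hR red δ₂ h₂) n i ⟶ B), ∃ h : E ⟶ B, ∀ i, ι i ≫ h = g i) ∧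
      ∀ (B : PrismOver p δA R₀) (h h' : E ⟶ B), (∀ i, ι i ≫ h = ι i ≫ h') → h = h' := by
  obtain ⟨E, β, ι, v, e₁, e₂, e₃, e₄⟩ :=
    exists_mixedCoproduct hA hR red hT δ₁ δ₂ h₁ h₂ hδ (Fin (n + 1))
  refine ⟨E, mixedCofan β ι, β, ι, v, rfl, e₁, e₂, fun B g => ?_, fun B h h' hh =>
    e₄ B h h' (hh none) fun j => hh (some j)⟩
  obtain ⟨h, f₁, f₂⟩ := e₃ B (g none) (fun j => g (some j))
  refine ⟨h, ?_⟩
  rintro (_ | j)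
  · exact f₁
  · exact f₂ j

include hT hδ in
theorem hasCoproduct_mixedFamily (n : ℕ) :
    HasCoproduct (mixedFamily (ofLift hA hR red δ₁ h₁) (ofLift hA hR red δ₂ h₂) n) := by
  obtain ⟨E, ι, β, γ, v, -, -, -, h₃, h₄⟩ :=
    exists_mixedFamily_coproduct hA hR red hT δ₁ δ₂ h₁ h₂ hδ n
  exact hasCoproduct_of_universal _ ι h₃ h₄

include hT hδ in
theorem exists_isPDPoly_mixedNerve (hP : ∀ n : ℕ, HasCoproduct
      (mixedFamily (ofLift hA hR red δ₁ h₁) (ofLift hA hR red δ₂ h₂) n)) (n : ℕ) :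
    ∃ w : Fin (n + 1) × Fin d → ((mixedNerve _ _ hP).obj (SimplexCategory.mk n)).carrier,
      (∀ j k, p * w (j, k) = Hom.ringHom (mixedNerveBase _ _ hP n) (T k) -
        Hom.ringHom (mixedNerveι _ _ hP n j) (T k)) ∧
      IsPDPoly p (Hom.ringHom (mixedNerveBase _ _ hP n)) w := by
  obtain ⟨E, ι, β, γ, v, rfl, e₁, e₂, h₃, h₄⟩ :=
    exists_mixedFamily_coproduct hA hR red hT δ₁ δ₂ h₁ h₂ hδ n
  have := hP n
  obtain ⟨α, hα⟩ := exists_iso_sigma _ _ h₃ h₄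
  have hβ : ∀ r, Hom.ringHom α.hom (Hom.ringHom β r) =
      Hom.ringHom (mixedNerveBase _ _ hP n) r := fun r =>
    congrArg (fun q => Hom.ringHom q r) (hα none)
  have hγ : ∀ j r, Hom.ringHom α.hom (Hom.ringHom (γ j) r) =
      Hom.ringHom (mixedNerveι _ _ hP n j) r := fun j r =>
    congrArg (fun q => Hom.ringHom q r) (hα (some j))
  refine ⟨fun s => Hom.ringHom α.hom (v s), fun j k => ?_,
    e₂.map_ringEquiv (PrismOver.crystalline _) (ringEquivOfIso α) hβ (fun _ => rfl)⟩
  have e := congrArg (Hom.ringHom α.hom) (e₁ j k)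
  rw [map_mul, map_natCast, map_sub] at e
  exact e.trans (congrArg₂ (· - ·) (hβ _) (hγ _ _))

set_option maxHeartbeats 1000000 in
include hT hδ in
theorem mixedNerve_description :
    let P₁ : PrismOver p δA R₀ := ofLift hA hR red δ₁ h₁
    let P₂ : PrismOver p δA R₀ := ofLift hA hR red δ₂ h₂
    ∃ (_ : HasBinaryCoproduct P₁ P₂)
      (hP : ∀ n : ℕ, HasCoproduct (mixedFamily P₁ P₂ n))
      (Y : Fin d → (P₁ ⨿ P₂).carrier),
      (∀ k, p * Y k = Hom.ringHom (coprod.inl : P₁ ⟶ P₁ ⨿ P₂) (T k) -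
        Hom.ringHom (coprod.inr : P₂ ⟶ P₁ ⨿ P₂) (T k)) ∧
      (∀ n : ℕ, ∃ κ : PDPoly p R (Fin d ⊕ Fin n × Fin d) ≃+*
          PDModel p (P₁ ⨿ P₂).carrier d n,
        (∀ r : R, κ (algebraMap R _ r) = algebraMap (P₁ ⨿ P₂).carrier _
          (Hom.ringHom (coprod.inl : P₁ ⟶ P₁ ⨿ P₂) r)) ∧
        (∀ k, κ (PDPoly.X p R (Sum.inl k)) = algebraMap (P₁ ⨿ P₂).carrier _ (Y k)) ∧
        (∀ s, κ (PDPoly.X p R (Sum.inr s)) = PDPoly.X p (P₁ ⨿ P₂).carrier s)) ∧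
      ∃ M : CosimplicialStructure (PDModel p (P₁ ⨿ P₂).carrier d),
        (∀ n i f, f = M.face n i ↔
          IsMixedFace p (Hom.ringHom (coprod.inl : P₁ ⟶ P₁ ⨿ P₂)) Y n i f) ∧
        (∀ n i f, f = M.degeneracy n i ↔ IsDegeneracy p (P₁ ⨿ P₂).carrier d n i f) ∧
        ∃ e : M.toCosimplicialObject ≅ mixedNerve P₁ P₂ hP ⋙ forgetToRing,
          ∀ n : ℕ,
            (∀ r : (P₁ ⨿ P₂).carrier, M.component e.hom n (algebraMap _ _ r) =
              Hom.ringHom (coprod.desc (mixedNerveBase P₁ P₂ hP n)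
                (mixedNerveι P₁ P₂ hP n 0)) r) ∧
            (∀ (j : Fin (n + 1)) (k : Fin d), j ≠ 0 →
              p * M.component e.hom n (pdVar p (P₁ ⨿ P₂).carrier d n j k) =
                Hom.ringHom (mixedNerveι P₁ P₂ hP n 0) (T k) -
                  Hom.ringHom (mixedNerveι P₁ P₂ hP n j) (T k)) := by
  intro P₁ P₂
  have hRc := hR.isCrystalline hA
  have hcop : HasBinaryCoproduct P₁ P₂ :=
    hasBinaryCoproduct_ofLift hA hR red hT δ₁ δ₂ h₁ h₂ hδ
  have hP : ∀ n : ℕ, HasCoproduct (mixedFamily P₁ P₂ n) :=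
    hasCoproduct_mixedFamily hA hR red hT δ₁ δ₂ h₁ h₂ hδ
  obtain ⟨Y, hY, hYpd⟩ := exists_isPDPoly_coprod hA hR red hT δ₁ δ₂ h₁ h₂ hδ
  let S := (P₁ ⨿ P₂).carrier
  let inl : R →+* S := Hom.ringHom (coprod.inl : P₁ ⟶ P₁ ⨿ P₂)
  have hYpd' : IsPDPoly p inl Y := hYpd
  have hSc : IsCrystalline p S := PrismOver.crystalline _
  have hmodel : ∀ n, IsPDPoly p ((algebraMap S (PDModel p S d n)).comp inl)
      (Sum.elim (algebraMap S (PDModel p S d n) ∘ Y) (PDPoly.X p S)) := fun n =>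
    hYpd'.trans (PDPoly.isPDPoly hSc)
  refine ⟨hcop, hP, Y, hY, fun n => ?_, ?_⟩
  · obtain ⟨κ, hκ₁, hκ₂⟩ := (PDPoly.isPDPoly hRc).exists_ringEquiv (hmodel n)
    exact ⟨κ, hκ₁, fun k => hκ₂ (Sum.inl k), fun s => hκ₂ (Sum.inr s)⟩
  let N := fun n : ℕ => ((mixedNerve P₁ P₂ hP).obj (SimplexCategory.mk n)).carrier
  let b : ∀ n, R →+* N n := fun n => Hom.ringHom (mixedNerveBase P₁ P₂ hP n)
  let c : ∀ n, Fin (n + 1) → R →+* N n := fun n j => Hom.ringHom (mixedNerveι P₁ P₂ hP n j)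
  have hw : ∀ n, ∃ w : Fin (n + 1) × Fin d → N n,
      (∀ j k, p * w (j, k) = b n (T k) - c n j (T k)) ∧ IsPDPoly p (b n) w :=
    exists_isPDPoly_mixedNerve hA hR red hT δ₁ δ₂ h₁ h₂ hδ hP
  choose w hw₁ hw₂ using hw
  have hNc : ∀ n, IsCrystalline p (N n) := fun n => (hw₂ n).crystalline
  have hE : ∀ n : ℕ, ∃ E : PDModel p S d n ≃+* N n,
      (∀ r : R, E (algebraMap S _ (inl r)) = b n r) ∧
      (∀ k, E (algebraMap S _ (Y k)) = w n (0, k)) ∧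
      ∀ (j : Fin (n + 1)) (k : Fin d), E (pdVar p S d n j k) = w n (j, k) - w n (0, k) :=
    fun n => by
      obtain ⟨E, hE₁, hE₂⟩ := (hmodel n).exists_ringEquiv (hw₂ n).sum_elim_sub
      refine ⟨E, hE₁, fun k => hE₂ (Sum.inl k), fun j k => ?_⟩
      induction j using Fin.cases with
      | zero => rw [Fin.val_zero, pdVar_zero, map_zero, sub_self]
      | succ j =>
        rw [Fin.val_succ, pdVar_succ]
        exact hE₂ (Sum.inr (j, k))
  choose E hE₁ hE₂ hE₃ using hE
  obtain ⟨M, e, hM, he⟩ := CosimplicialStructure.exists_of_ringEquiv (mixedNerve P₁ P₂ hP)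
    (S := PDModel p S d) (fun n => E n.len)
  let ν : ∀ {m n : ℕ} (_ : SimplexCategory.mk m ⟶ SimplexCategory.mk n), N m →+* N n :=
    fun θ => Hom.ringHom ((mixedNerve P₁ P₂ hP).map θ)
  have hM' : ∀ {m n : ℕ} (θ : SimplexCategory.mk m ⟶ SimplexCategory.mk n)
      (x : PDModel p S d m), E n (M.map θ x) = ν θ (E m x) := fun θ x => hM θ x
  have hνb : ∀ {m n : ℕ} (θ : SimplexCategory.mk m ⟶ SimplexCategory.mk n) (r : R),
      ν θ (b m r) = b n r := fun θ r =>
    congrArg (fun q => Hom.ringHom q r) (mixedNerveBase_map P₁ P₂ hP θ)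
  have hνc : ∀ {m n : ℕ} (θ : SimplexCategory.mk m ⟶ SimplexCategory.mk n) (j : Fin (m + 1))
      (r : R), ν θ (c m j r) = c n (θ.toOrderHom j) r := fun θ j r =>
    congrArg (fun q => Hom.ringHom q r) (mixedNerveι_map P₁ P₂ hP θ j)
  -- Since `T` is fixed and `S_j` moves to `S_{θ j}`, the symmetric variables `w_j = (T - S_j) / p`
  -- are merely relabelled.
  have hνw : ∀ {m n : ℕ} (θ : SimplexCategory.mk m ⟶ SimplexCategory.mk n) (j : Fin (m + 1))
      (k : Fin d), ν θ (w m (j, k)) = w n (θ.toOrderHom j, k) := fun {m n} θ j k => by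
    apply (hNc n).p_cancel
    have e₁ := congrArg (ν θ) (hw₁ m j k)
    rw [map_mul, map_natCast, map_sub, hνb, hνc] at e₁
    exact e₁.trans (hw₁ n _ k).symm
  have hMbase : ∀ {m n : ℕ} (θ : SimplexCategory.mk m ⟶ SimplexCategory.mk n) (r : R),
      M.map θ (algebraMap S (PDModel p S d m) (inl r)) =
        algebraMap S (PDModel p S d n) (inl r) := fun {m n} θ r => (E n).injective <| by
    rw [hM', hE₁, hE₁, hνb]
  -- `Y` is `w_0`, which moves to `w_{θ 0} = Y + Z_{θ 0}`.
  have hMY : ∀ {m n : ℕ} (θ : SimplexCategory.mk m ⟶ SimplexCategory.mk n) (k : Fin d),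
      M.map θ (algebraMap S (PDModel p S d m) (Y k)) =
        algebraMap S (PDModel p S d n) (Y k) +
          pdVar p S d n (θ.toOrderHom 0 : Fin (n + 1)) k := fun {m n} θ k =>
    (E n).injective <| by
      rw [hM', hE₂, map_add, hE₂, hE₃, hνw, add_sub_cancel]
  have hMY₀ : ∀ {m n : ℕ} (θ : SimplexCategory.mk m ⟶ SimplexCategory.mk n)
      (_ : (θ.toOrderHom 0 : Fin (n + 1)) = 0) (k : Fin d),
      M.map θ (algebraMap S (PDModel p S d m) (Y k)) =
        algebraMap S (PDModel p S d n) (Y k) := fun θ h k =>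
    (hMY θ k).trans (by rw [h, Fin.val_zero, pdVar_zero, add_zero])
  have hMvar : ∀ {m n : ℕ} (θ : SimplexCategory.mk m ⟶ SimplexCategory.mk n) (j : Fin (m + 1))
      (k : Fin d), M.map θ (pdVar p S d m j k) =
        pdVar p S d n (θ.toOrderHom j : Fin (n + 1)) k -
          pdVar p S d n (θ.toOrderHom 0 : Fin (n + 1)) k := fun {m n} θ j k =>
    (E n).injective <| by
      rw [hM', hE₃, map_sub, map_sub, hE₃, hE₃, hνw, hνw, sub_sub_sub_cancel_right]
  have hface : ∀ n (i : Fin (n + 2)), IsMixedFace p inl Y n i (M.face n i) := fun n i =>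
    { onBase := hMbase (SimplexCategory.δ i)
      onY := fun k => by
        split_ifs with hi
        · have hi' : i = 0 := Fin.ext hi
          rw [hi']
          exact hMY (SimplexCategory.δ 0) k
        · exact hMY₀ (SimplexCategory.δ i) (Fin.succAbove_ne_zero_zero
            (fun hi' : i = 0 => hi (by rw [hi', Fin.val_zero]))) k
      onVars := faceOnVars_of_succAbove (hMvar (SimplexCategory.δ i)) }
  have hdeg : ∀ n (i : Fin (n + 1)), IsDegeneracy p S d n i (M.degeneracy n i) := fun n i =>
    -- A degeneracy fixes the index `0`, hence `Y`; being also `R₁`-linear it is `R₁₂`-linear.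
    { onBase := fun r => RingHom.congr_fun (hYpd'.hom_ext (PDPoly.crystalline hSc)
        ((M.degeneracy n i).comp (algebraMap S _)) (algebraMap S _)
        (hMbase (SimplexCategory.σ i)) fun k => hMY₀ (SimplexCategory.σ i)
          (Fin.predAbove_right_zero (i := i)) k) r
      onVars := degeneracy_onVars_of_predAbove (hMvar (SimplexCategory.σ i)) }
  refine ⟨M, fun n i f => ⟨fun hf => hf ▸ hface n i, fun hf => hf.unique hYpd' (hface n i)⟩,
    fun n i f => ⟨fun hf => hf ▸ hdeg n i, fun hf => hf.unique hSc (hdeg n i)⟩, e,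
    fun n => ⟨fun r => ?_, fun j k _ => ?_⟩⟩
  · rw [he]
    let D : S →+* N n := Hom.ringHom (coprod.desc (mixedNerveBase P₁ P₂ hP n)
      (mixedNerveι P₁ P₂ hP n 0))
    have hDinl : ∀ r : R, D (inl r) = b n r := fun r =>
      congrArg (fun q => Hom.ringHom q r) (coprod.inl_desc (mixedNerveBase P₁ P₂ hP n)
        (mixedNerveι P₁ P₂ hP n 0))
    have hDinr : ∀ r : R, D (Hom.ringHom (coprod.inr : P₂ ⟶ P₁ ⨿ P₂) r) = c n 0 r := fun r =>
      congrArg (fun q => Hom.ringHom q r) (coprod.inr_desc (mixedNerveBase P₁ P₂ hP n)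
        (mixedNerveι P₁ P₂ hP n 0))
    -- Maps out of `R₁₂` are compared on `R₁` and `Y`; on `Y` both sides become `T - S_0` after
    -- multiplication by `p`.
    refine RingHom.congr_fun (hYpd'.hom_ext (hNc n)
      ((E n : PDModel p S d n →+* N n).comp (algebraMap S _)) D (fun r => ?_) fun k => ?_) r
    · exact (hE₁ n r).trans (hDinl r).symm
    · refine (hE₂ n k).trans ((hNc n).p_cancel ?_)
      have e₁ := congrArg D (hY k)
      rw [map_mul, map_natCast, map_sub] at e₁
      exact (hw₁ n 0 k).trans
        (e₁.trans (congrArg₂ (· - ·) (hDinl (T k)) (hDinr (T k)))).symm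
  · rw [he]
    have e₁ : p * E n (pdVar p S d n j k) = c n 0 (T k) - c n j (T k) := by
      rw [hE₃, mul_sub, hw₁, hw₁]
      ring
    exact e₁

end PrismOver

theorem corollary3p9 (p : ℕ) [Fact p.Prime]
    {A : Type u} [CommRing A] (δA : DeltaStructure p A) (hA : IsCrystalline p A)
    {R₀ : Type u} [CommRing R₀] [Algebra A R₀]
    [Algebra (A ⧸ Ideal.span {(p : A)}) R₀] [IsScalarTower A (A ⧸ Ideal.span {(p : A)}) R₀]
    (d : ℕ)
    (chart : AddMonoidAlgebra (A ⧸ Ideal.span {(p : A)}) (Fin d → ℤ)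
      →ₐ[A ⧸ Ideal.span {(p : A)}] R₀)
    (hchart : chart.toRingHom.Etale)
    {R : Type u} [CommRing R] [Algebra A R] (hR : IsPCompletelySmooth p A R)
    (red : (R ⧸ Ideal.span {(p : R)}) ≃ₐ[A] R₀)
    (T : Fin d → R)
    (hT : ∀ k, red (Ideal.Quotient.mk _ (T k)) =
      chart (AddMonoidAlgebra.single (Pi.single k 1) 1))
    (δ₁ δ₂ : DeltaStructure p R) (h₁ : δ₁.IsCompatible δA) (h₂ : δ₂.IsCompatible δA)
    (hδ : ∀ x : R, δ₁.δ x - δ₂.δ x ∈ Ideal.span {(p : R)}) :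
    -- the self-nerves of `R₁` and of `R₂`
    (∀ (δ : DeltaStructure p R) (h : δ.IsCompatible δA), δ = δ₁ ∨ δ = δ₂ →
      let P : PrismOver p δA R₀ := PrismOver.ofLift hA hR red δ h
      ∃ hP : ∀ n : ℕ, HasCoproduct (fun _ : Fin (n + 1) => P),
      ∃ M : CosimplicialStructure (PDModel p R d),
        (∀ n i f, f = M.face n i ↔ IsSelfFace p A T n i f) ∧
        (∀ n i f, f = M.degeneracy n i ↔ IsDegeneracy p R d n i f) ∧
        ∃ e : M.toCosimplicialObject ≅ selfNerve P hP ⋙ PrismOver.forgetToRing,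
          ∀ n : ℕ,
            (∀ r : R, M.component e.hom n (algebraMap R _ r) =
              PrismOver.Hom.ringHom (selfNerveι P hP n 0) r) ∧
            (∀ (j : Fin (n + 1)) (k : Fin d), j ≠ 0 →
              p * M.component e.hom n (pdVar p R d n j k) =
                PrismOver.Hom.ringHom (selfNerveι P hP n 0) (T k) -
                  PrismOver.Hom.ringHom (selfNerveι P hP n j) (T k))) ∧
    -- the mixed nerve
    (let P₁ : PrismOver p δA R₀ := PrismOver.ofLift hA hR red δ₁ h₁
      let P₂ : PrismOver p δA R₀ := PrismOver.ofLift hA hR red δ₂ h₂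
      ∃ (_ : HasBinaryCoproduct P₁ P₂)
        (hP : ∀ n : ℕ, HasCoproduct (mixedFamily P₁ P₂ n))
        (Y : Fin d → (P₁ ⨿ P₂).carrier),
        (∀ k, p * Y k = PrismOver.Hom.ringHom (coprod.inl : P₁ ⟶ P₁ ⨿ P₂) (T k) -
          PrismOver.Hom.ringHom (coprod.inr : P₂ ⟶ P₁ ⨿ P₂) (T k)) ∧
        (∀ n : ℕ, ∃ κ : PDPoly p R (Fin d ⊕ Fin n × Fin d) ≃+*
            PDModel p (P₁ ⨿ P₂).carrier d n,
          (∀ r : R, κ (algebraMap R _ r) = algebraMap (P₁ ⨿ P₂).carrier _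
            (PrismOver.Hom.ringHom (coprod.inl : P₁ ⟶ P₁ ⨿ P₂) r)) ∧
          (∀ k, κ (PDPoly.X p R (Sum.inl k)) = algebraMap (P₁ ⨿ P₂).carrier _ (Y k)) ∧
          (∀ s, κ (PDPoly.X p R (Sum.inr s)) = PDPoly.X p (P₁ ⨿ P₂).carrier s)) ∧
        ∃ M : CosimplicialStructure (PDModel p (P₁ ⨿ P₂).carrier d),
          (∀ n i f, f = M.face n i ↔
            IsMixedFace p (PrismOver.Hom.ringHom (coprod.inl : P₁ ⟶ P₁ ⨿ P₂)) Y n i f) ∧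
          (∀ n i f, f = M.degeneracy n i ↔ IsDegeneracy p (P₁ ⨿ P₂).carrier d n i f) ∧
          ∃ e : M.toCosimplicialObject ≅ mixedNerve P₁ P₂ hP ⋙ PrismOver.forgetToRing,
            ∀ n : ℕ,
              (∀ r : (P₁ ⨿ P₂).carrier, M.component e.hom n (algebraMap _ _ r) =
                PrismOver.Hom.ringHom (coprod.desc (mixedNerveBase P₁ P₂ hP n)
                  (mixedNerveι P₁ P₂ hP n 0)) r) ∧
              (∀ (j : Fin (n + 1)) (k : Fin d), j ≠ 0 →
                p * M.component e.hom n (pdVar p (P₁ ⨿ P₂).carrier d n j k) =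
                  PrismOver.Hom.ringHom (mixedNerveι P₁ P₂ hP n 0) (T k) -
                    PrismOver.Hom.ringHom (mixedNerveι P₁ P₂ hP n j) (T k))) := by
  have hTc : IsEtaleCoordinates p A T :=
    (hasDerivationCoordinates_of_etale chart hchart red T hT).isEtaleCoordinates hR
  exact ⟨fun δ h _ => PrismOver.selfNerve_description hA hR red hTc δ h,
    PrismOver.mixedNerve_description hA hR red hTc δ₁ δ₂ h₁ h₂
      fun x => Ideal.mem_span_singleton.mp (hδ x)⟩
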